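/- All graphs are finite and may have parallel edges but no loops; a graph is simple if it has no parallel edges. A snark is a bridgeless cubic graph that is not 3-edge-colorable. An automorphism of a graph $G$ is a permutation $\alpha$ of $V(G)$ that preserves the number of edges between any two vertices; $d_\alpha(v)$ denotes the smallest positive integer $k$ with $\alpha^k(v)=v$. For an integer $i$, $T_i^3$ denotes the unique tree with all vertex degrees in $\{1,3\}$ that has a vertex (its root) at distance $i$ from every leaf. A $3$-graph is a $3$-regular graph in which $|\partial(S)|\ge 3$ for every set $S$ of vertices of odd cardinality, where $\partial(S)$ is the set of edges with precisely one end in $S$. A $3$-graph $G$ is a rotation $3$-graph if, for some integer $i$, it has a spanning tree $T$ isomorphic to $T_i^3$ and an automorphism $\alpha$ of $G$ that is also an automorphism of $T$ and satisfies $d_\alpha(x)=1$ for the root $x$ of $T$ and $d_\alpha(u)=3$ for every other vertex $u$. A rotation snark is a snark that is a rotation $3$-graph. A nowhere-zero $k$-flow of $G$ is an orientation of the edges of $G$ together with a map $f:E(G)\to\{\pm1,\dots,\pm(k-1)\}$ such that at every vertex the sum of $f$ over the incoming edges equals the sum of $f$ over the outgoing edges. Corollary. Every snark admits a nowhere-zero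 $5$-flow if and only if every simple rotation snark admits a nowhere-zero $5$-flow. -/

import Mathlib

open scoped Graph

/-!
Multigraphs are Mathlib's `Graph α β` (vertex set `V(G) : Set α`, edge set `E(G) : Set β`,
`G.IsLink e x y` if the edge `e` has the ends `x`, `y`). The graphs considered are finite and
may have parallel edges, but no loops.
-/

namespace SnarkFlow

universe u v

/-- A finite graph without loops (parallel edges are allowed). -/
structure IsFiniteLoopless {α : Type u} {β : Type v} (G : Graph α β) : Prop where
  finite_vertexSet : V(G).Finite
  finite_edgeSet : E(G).Finite
  loopless : G.Loopless

/-- The degree of a vertex of a loopless graph: the number of edges incident with it. -/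
noncomputable def degree {α : Type u} {β : Type v} (G : Graph α β) (x : α) : ℕ :=
  (G.incidenceSet x).ncard

/-- Every vertex has degree `r`. -/
def IsRegular {α : Type u} {β : Type v} (G : Graph α β) (r : ℕ) : Prop :=
  ∀ x ∈ V(G), degree G x = r

/-- The set of edges with precisely one end in `S`, for `S ⊆ V(G)`. -/
def boundary {α : Type u} {β : Type v} (G : Graph α β) (S : Set α) : Set β :=
  {e | ∃ x ∈ S, ∃ y ∉ S, G.IsLink e x y}

/-- The edge `e` is a bridge: its ends lie in different components of `G - e`. -/
def IsBridge {α : Type u} {β : Type v} (G : Graph α β) (e : β) : Prop :=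
  ∃ x y, G.IsLink e x y ∧ ¬ Relation.ReflTransGen (G.deleteEdges {e}).Adj x y

/-- `G` has a proper edge colouring with `k` colours: distinct edges with a common end get
distinct colours. -/
def EdgeColorable {α : Type u} {β : Type v} (G : Graph α β) (k : ℕ) : Prop :=
  ∃ c : E(G) → Fin k, ∀ (e f : E(G)) (x : α), e ≠ f → G.Inc e x → G.Inc f x → c e ≠ c f

/-- A snark is a bridgeless cubic graph that is not 3-edge-colourable. -/
structure IsSnark {α : Type u} {β : Type v} (G : Graph α β) : Prop where
  finite_loopless : IsFiniteLoopless G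
  cubic : IsRegular G 3
  bridgeless : ∀ e, ¬ IsBridge G e
  not_edgeColorable : ¬ EdgeColorable G 3

/-- An `r`-graph is an `r`-regular graph with `|∂(S)| ≥ r` for every vertex set `S` of odd
cardinality. -/
structure IsRGraph {α : Type u} {β : Type v} (G : Graph α β) (r : ℕ) : Prop where
  finite_loopless : IsFiniteLoopless G
  regular : IsRegular G r
  le_boundary : ∀ S ⊆ V(G), Odd S.ncard → r ≤ (boundary G S).ncard

/-- An automorphism of `G`: the number of edges between two vertices is preserved. -/
def IsAutomorphism {α : Type u} {β : Type v} (G : Graph α β) (σ : Equiv.Perm V(G)) : Prop :=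
  ∀ x y : V(G), {e | G.IsLink e (σ x) (σ y)}.ncard = {e | G.IsLink e x y}.ncard

/-- `T` is isomorphic to the tree `T_i^r` by an isomorphism which takes `root` to its root: all
degrees of the tree `T` are `1` or `r`, and every leaf has distance `i` from `root`. -/
structure IsRootedTree {V : Type u} (T : SimpleGraph V) (r i : ℕ) (root : V) : Prop where
  isTree : T.IsTree
  degrees : ∀ x, (T.neighborSet x).ncard = 1 ∨ (T.neighborSet x).ncard = r
  dist_leaf : ∀ x, (T.neighborSet x).ncard = 1 → T.dist root x = i

/-- An automorphism `σ` of the tree `T` which is rotational with respect to the vertex `v`: the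
least positive `k` with `σ ^ k` fixing `x` is `1` for `x = v`, and is the degree of `v` for every
other vertex `x` (`Function.minimalPeriod` is this `k`; it exists when `T` is finite). -/
structure IsRotational {V : Type u} (T : SimpleGraph V) (v : V) (σ : Equiv.Perm V) : Prop where
  adj_iff : ∀ x y, T.Adj (σ x) (σ y) ↔ T.Adj x y
  period_self : Function.minimalPeriod σ v = 1
  period_of_ne : ∀ x, x ≠ v → Function.minimalPeriod σ x = (T.neighborSet v).ncard

/-- `G` is a rotation `T_i^r`-graph: an `r`-regular graph with a spanning tree `T` isomorphic to
`T_i^r` and an automorphism of `G` which is rotational on `T` with respect to the root of `T`.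
A spanning tree is a tree on the vertex set `V(G)` any two neighbours of which are adjacent in `G`.
(Which one of several parallel edges of `G` it uses does not matter here, since automorphisms
are maps of the vertices.) -/
def IsRotationTreeGraph {α : Type u} {β : Type v} (G : Graph α β) (r i : ℕ) : Prop :=
  IsFiniteLoopless G ∧ IsRegular G r ∧
    ∃ (T : SimpleGraph V(G)) (root : V(G)) (σ : Equiv.Perm V(G)),
      T ≤ G.toSimpleGraph ∧ IsRootedTree T r i root ∧ IsAutomorphism G σ ∧ IsRotational T root σ

/-- A rotation `r`-graph is an `r`-graph that is a rotation `T_i^r`-graph for some `i`. -/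
def IsRotationRGraph {α : Type u} {β : Type v} (G : Graph α β) (r : ℕ) : Prop :=
  IsRGraph G r ∧ ∃ i : ℕ, IsRotationTreeGraph G r i

/-- A rotation snark is a snark that is a rotation `3`-graph. -/
def IsRotationSnark {α : Type u} {β : Type v} (G : Graph α β) : Prop :=
  IsSnark G ∧ IsRotationRGraph G 3

/-- `G` admits a nowhere-zero `k`-flow: there are an orientation of the edges (the edge `e` goes
from `tail e` to `head e`) and a map `f` from the edges to `{±1, …, ±(k - 1)}` such that at
every vertex the sum of `f` over the incoming edges is the sum of `f` over the outgoing edges. -/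
def HasNowhereZeroFlow {α : Type u} {β : Type v} (G : Graph α β) (k : ℕ) : Prop :=
  ∃ (tail head : E(G) → α) (f : E(G) → ℤ),
    (∀ e : E(G), G.IsLink e (tail e) (head e)) ∧
    (∀ e : E(G), f e ≠ 0 ∧ |f e| < (k : ℤ)) ∧
    ∀ x ∈ V(G), ∑ᶠ e ∈ {e : E(G) | head e = x}, f e = ∑ᶠ e ∈ {e : E(G) | tail e = x}, f e

end SnarkFlow

/-! Only the passage from arbitrary snarks to simple rotation snarks needs work. From a snark `G`
one builds a simple rotation snark `H` such that every flow on `H`, over any abelian group and with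
any set of allowed values, yields a flow on `G` with values in the same set. Over `ℤ` this transfers
nowhere-zero 5-flows. Over the Klein four-group, where nowhere-zero flows are 3-edge-colourings, it
shows that `H` is not 3-edge-colourable.

Construction: `G` is made connected by cutting one edge in each component and joining the ends
cyclically. As no edge is a bridge, there is a spanning tree avoiding a chosen edge at its root.
Take three copies (branches) of the tree and cut the edges off it. The root's half of the chosen
edge goes to a new common root. Every other half-edge off the tree receives a binary tree, of such a
height that all leaves are equally far from the new root. The leaves of the two trees belonging to
one cut edge form a cycle; the tree at the far end of the chosen edge has no partner, and its three
copies share one cycle. Shifting the branches cyclically is the required rotation.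

Flows descend because the gadget that replaces an edge is attached by a two-edge cut, whose values
sum to zero (`isFlow_of_rotation`). `H` is bridgeless because a vertex set cutting at most one edge
can be followed around that edge (`bridgeless_rotation`); being a 3-graph is then a matter of
parity. -/

namespace SnarkFlow

/-! ### Half-edges, flows and bridges -/

/-- A loopless cubic multigraph on `V`, presented by its half-edges: `(v, i)` is the `i`-th
half-edge at `v`, and `inv` interchanges the two halves of an edge. -/
structure CubicMap (V : Type) where
  inv : V × Fin 3 → V × Fin 3
  inv_inv : ∀ d, inv (inv d) = d
  fst_inv_ne : ∀ d, (inv d).1 ≠ d.1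

namespace CubicMap

variable {V : Type} {A : Type} [AddCommGroup A]

attribute [simp] CubicMap.inv_inv

lemma inv_ne (M : CubicMap V) (d : V × Fin 3) : M.inv d ≠ d := fun h =>
  M.fst_inv_ne d (by rw [h])

lemma inv_injective (M : CubicMap V) : Function.Injective M.inv := fun a b h => by
  rw [← M.inv_inv a, h, M.inv_inv]

lemma inv_eq_iff (M : CubicMap V) {d e : V × Fin 3} : M.inv d = e ↔ d = M.inv e :=
  ⟨fun h => by rw [← h, M.inv_inv], fun h => by rw [h, M.inv_inv]⟩

/-- `f` is a flow with values in `S`; `f d` is the amount leaving the end of the half-edge `d`. -/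
structure IsFlow (M : CubicMap V) (S : Set A) (f : V × Fin 3 → A) : Prop where
  antisymm : ∀ d, f (M.inv d) = -f d
  conserve : ∀ v, ∑ i, f (v, i) = 0
  mem : ∀ d, f d ∈ S

/-- No edge is a bridge: a vertex set which only `d` could leave contains both ends of `d`. -/
def Bridgeless (M : CubicMap V) : Prop :=
  ∀ (d : V × Fin 3) (X : Set V), d.1 ∈ X →
    (∀ e, e ≠ d → e ≠ M.inv d → e.1 ∈ X → (M.inv e).1 ∈ X) → (M.inv d).1 ∈ X

/-- A nonempty vertex set which no edge leaves contains all vertices. -/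
def Connected (M : CubicMap V) : Prop :=
  ∀ X : Set V, X.Nonempty → (∀ d, d.1 ∈ X → (M.inv d).1 ∈ X) → ∀ v, v ∈ X

/-- Values cancel in pairs because `inv` has no fixed points; nothing is divided by two, so groups
with 2-torsion are allowed. -/
lemma sum_eq_zero_of_closed (M : CubicMap V) (f : V × Fin 3 → A) (s : Finset (V × Fin 3))
    (hs : ∀ d ∈ s, M.inv d ∈ s) (hf : ∀ d ∈ s, f (M.inv d) = -f d) : ∑ d ∈ s, f d = 0 :=
  Finset.sum_involution (fun d _ => M.inv d) (fun d hd => by rw [hf d hd, add_neg_cancel])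
    (fun d _ _ => M.inv_ne d) hs (fun d _ => M.inv_inv d)

open scoped Classical in
lemma sum_eq_sum_crossing [Fintype V] (M : CubicMap V) (f : V × Fin 3 → A)
    (hf : ∀ d, f (M.inv d) = -f d) (X : Set V) :
    ∑ d with d.1 ∈ X, f d = ∑ d with d.1 ∈ X ∧ (M.inv d).1 ∉ X, f d := by
  have h0 : ∑ d with d.1 ∈ X ∧ (M.inv d).1 ∈ X, f d = 0 :=
    M.sum_eq_zero_of_closed f _ (by simp +contextual) (fun d _ => hf d)
  rw [← Finset.sum_filter_add_sum_filter_not (Finset.univ.filter fun d : V × Fin 3 => d.1 ∈ X)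
    (fun d => (M.inv d).1 ∈ X), Finset.filter_filter, Finset.filter_filter, h0, zero_add]

open scoped Classical in
lemma sum_fst_mem [Fintype V] (f : V × Fin 3 → A) (X : Set V) :
    ∑ d with d.1 ∈ X, f d = ∑ v with v ∈ X, ∑ i, f (v, i) := by
  rw [← Finset.sum_product']
  refine Finset.sum_congr ?_ fun _ _ => rfl
  ext d
  simp

open scoped Classical in
lemma IsFlow.sum_fst_mem_eq_zero [Fintype V] {M : CubicMap V} {S : Set A} {f : V × Fin 3 → A}
    (hf : M.IsFlow S f) (X : Set V) : ∑ d with d.1 ∈ X, f d = 0 := by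
  rw [sum_fst_mem]
  exact Finset.sum_eq_zero fun v _ => hf.conserve v

open scoped Classical in
lemma IsFlow.sum_crossing [Fintype V] {M : CubicMap V} {S : Set A} {f : V × Fin 3 → A}
    (hf : M.IsFlow S f) (X : Set V) : ∑ d with d.1 ∈ X ∧ (M.inv d).1 ∉ X, f d = 0 := by
  rw [← M.sum_eq_sum_crossing f hf.antisymm, hf.sum_fst_mem_eq_zero]

/-- A bridge `d` would carry the whole net flow out of one side, which is zero. -/
lemma IsFlow.bridgeless [Finite V] {M : CubicMap V} {S : Set A} {f : V × Fin 3 → A}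
    (hf : M.IsFlow S f) (hS : (0 : A) ∉ S) : M.Bridgeless := by
  classical
  have := Fintype.ofFinite V
  intro d X hd hX
  by_contra h
  have := hf.sum_crossing X
  have hs : (Finset.univ.filter fun e : V × Fin 3 => e.1 ∈ X ∧ (M.inv e).1 ∉ X) = {d} := by
    ext e
    simp only [Finset.mem_filter, Finset.mem_univ, true_and, Finset.mem_singleton]
    constructor
    · rintro ⟨h1, h2⟩
      by_contra hne
      by_cases he : e = M.inv d
      · exact h (he ▸ h1)
      · exact h2 (hX e hne he h1)
    · rintro rfl
      exact ⟨hd, h⟩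
  rw [hs, Finset.sum_singleton] at this
  exact hS (this ▸ hf.mem d)

lemma Bridgeless.exists_flow_ne_zero [Finite V] {M : CubicMap V} (hM : M.Bridgeless)
    (d : V × Fin 3) : ∃ f : V × Fin 3 → ℝ, M.IsFlow Set.univ f ∧ f d ≠ 0 := by
  classical
  let unit : V × Fin 3 → V × Fin 3 → ℝ := fun e x =>
    (if x = e then 1 else 0) - (if x = M.inv e then 1 else 0)
  have unit_inv : ∀ e x, unit e (M.inv x) = -unit e x := by
    intro e x
    simp only [unit, M.inv_injective.eq_iff, M.inv_eq_iff (d := x)]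
    ring
  have unit_sum : ∀ e v, ∑ i, unit e (v, i) =
      (if v = e.1 then 1 else 0) - (if v = (M.inv e).1 then 1 else 0) := by
    have key : ∀ (e : V × Fin 3) (v : V),
        ∑ i, (if (v, i) = e then (1 : ℝ) else 0) = if v = e.1 then 1 else 0 := by
      rintro ⟨w, k⟩ v
      by_cases h : v = w <;> simp [h]
    intro e v
    simp only [unit, Finset.sum_sub_distrib, key]
  -- The vertices `v` that a unit flow from `d.1` reaches without using `d`. Bridgelessness puts the
  -- other end of `d` in `X`; subtracting `unit d` then closes the flow to a circulation through
  -- `d`.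
  let X : Set V := {v | ∃ g : V × Fin 3 → ℝ, (∀ x, g (M.inv x) = -g x) ∧ g d = 0 ∧
    ∀ w, ∑ i, g (w, i) = (if w = d.1 then 1 else 0) - (if w = v then 1 else 0)}
  obtain ⟨g, hg1, hg2, hg3⟩ : (M.inv d).1 ∈ X := by
    refine hM d X ⟨0, by simp, rfl, by simp⟩ ?_
    rintro e h1 h2 ⟨g, hg1, hg2, hg3⟩
    refine ⟨fun x => g x + unit e x, fun x => by simp only [hg1, unit_inv]; ring, ?_, fun w => ?_⟩
    · have h3 : ¬ d = M.inv e := fun h => h2 (by rw [h, M.inv_inv])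
      simp [hg2, unit, Ne.symm h1, h3]
    · rw [Finset.sum_add_distrib, hg3, unit_sum]
      ring
  refine ⟨fun x => g x - unit d x, ⟨fun x => by rw [hg1, unit_inv]; ring, fun w => ?_,
    fun _ => trivial⟩, ?_⟩
  · rw [Finset.sum_sub_distrib, hg3, unit_sum]
    ring
  · simp [hg2, unit, (M.inv_ne d).symm]

/-- A generic combination of circulations through the single edges vanishes nowhere. With
`IsFlow.bridgeless` this makes bridgelessness equivalent to a nowhere-zero real flow, the form in
which it passes through `relabel` and `merge`. -/
lemma Bridgeless.exists_flow [Finite V] {M : CubicMap V} (hM : M.Bridgeless) :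
    ∃ f : V × Fin 3 → ℝ, M.IsFlow {0}ᶜ f := by
  classical
  have := Fintype.ofFinite V
  suffices h : ∀ s : Finset (V × Fin 3), ∃ f : V × Fin 3 → ℝ, M.IsFlow Set.univ f ∧
      ∀ d ∈ s, f d ≠ 0 by
    obtain ⟨f, hf, h0⟩ := h Finset.univ
    exact ⟨f, hf.antisymm, hf.conserve, fun d => h0 d (Finset.mem_univ d)⟩
  intro s
  induction s using Finset.induction_on with
  | empty => exact ⟨0, ⟨by simp, by simp, fun _ => trivial⟩, by simp⟩
  | insert d s _ ih =>
    obtain ⟨f, hf, hfs⟩ := ih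
    obtain ⟨g, hg, hgd⟩ := hM.exists_flow_ne_zero d
    -- These are the values of `t` for which `f + t * g` vanishes at some `e` with `g e ≠ 0`; where
    -- `g e = 0` the quotient only excludes `0` needlessly.
    obtain ⟨t, ht⟩ := Infinite.exists_notMem_finset ((insert d s).image fun e => -f e / g e)
    refine ⟨fun x => f x + t * g x, ⟨fun x => ?_, fun v => ?_, fun _ => trivial⟩, ?_⟩
    · rw [hf.antisymm, hg.antisymm]
      ring
    · rw [Finset.sum_add_distrib, ← Finset.mul_sum, hf.conserve, hg.conserve]
      simp
    · intro e he h0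
      by_cases hge : g e = 0
      · rcases Finset.mem_insert.1 he with rfl | he
        · exact hgd hge
        · exact hfs e he (by simpa [hge] using h0)
      · refine ht (Finset.mem_image.2 ⟨e, he, ?_⟩)
        rw [div_eq_iff hge]
        linarith

/-- Renumber the half-edges at each vertex. -/
def relabel (M : CubicMap V) (π : V → Equiv.Perm (Fin 3)) : CubicMap V where
  inv d := ((M.inv (d.1, π d.1 d.2)).1,
    (π (M.inv (d.1, π d.1 d.2)).1).symm (M.inv (d.1, π d.1 d.2)).2)
  inv_inv d := by simp
  fst_inv_ne d := M.fst_inv_ne _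

lemma isFlow_relabel_iff {M : CubicMap V} {π : V → Equiv.Perm (Fin 3)} {S : Set A}
    {f : V × Fin 3 → A} :
    (M.relabel π).IsFlow S (fun d => f (d.1, π d.1 d.2)) ↔ M.IsFlow S f := by
  constructor
  · rintro ⟨h1, h2, h3⟩
    refine ⟨fun d => ?_, fun v => ?_, fun d => ?_⟩
    · simpa [relabel] using h1 (d.1, (π d.1).symm d.2)
    · rw [← h2 v]
      exact (Equiv.sum_comp (π v) fun i => f (v, i)).symm
    · simpa using h3 (d.1, (π d.1).symm d.2)
  · rintro ⟨h1, h2, h3⟩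
    refine ⟨fun d => ?_, fun v => ?_, fun d => h3 _⟩
    · simpa [relabel] using h1 (d.1, π d.1 d.2)
    · rw [← h2 v]
      exact Equiv.sum_comp (π v) fun i => f (v, i)

lemma IsFlow.of_relabel {M : CubicMap V} {π : V → Equiv.Perm (Fin 3)} {S : Set A}
    {f : V × Fin 3 → A} (hf : (M.relabel π).IsFlow S f) :
    M.IsFlow S (fun d => f (d.1, (π d.1).symm d.2)) := by
  rw [← isFlow_relabel_iff (π := π)]
  simpa using hf

lemma Bridgeless.relabel [Finite V] {M : CubicMap V} (hM : M.Bridgeless)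
    (π : V → Equiv.Perm (Fin 3)) : (M.relabel π).Bridgeless := by
  obtain ⟨f, hf⟩ := hM.exists_flow
  exact (isFlow_relabel_iff.2 hf).bridgeless (by simp)

end CubicMap

/-! ### Joining the components -/

namespace CubicMap

variable {V : Type}

/-- The type of connected components. -/
def Component (M : CubicMap V) : Type := Quot fun v w => ∃ i, (M.inv (v, i)).1 = w

/-- The component of a vertex. -/
def comp (M : CubicMap V) (v : V) : M.Component := Quot.mk _ v

lemma comp_inv (M : CubicMap V) (d : V × Fin 3) : M.comp (M.inv d).1 = M.comp d.1 :=
  (Quot.sound ⟨d.2, rfl⟩).symm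

lemma mem_of_comp_eq (M : CubicMap V) {X : Set V} (hX : ∀ d, d.1 ∈ X → (M.inv d).1 ∈ X)
    {v w : V} (h : M.comp v = M.comp w) (hv : v ∈ X) : w ∈ X := by
  have key : ∀ v w, (∃ i, (M.inv (v, i)).1 = w) → (v ∈ X) = (w ∈ X) := by
    rintro v _ ⟨i, rfl⟩
    refine propext ⟨hX (v, i), fun h => ?_⟩
    simpa using hX _ h
  have := congrArg (Quot.lift (fun v => v ∈ X) key) h
  exact (show (v ∈ X) = (w ∈ X) from this) ▸ hv

/-- A half-edge of each component. -/
noncomputable def dart (M : CubicMap V) (C : M.Component) : V × Fin 3 := (Quot.out C, 0)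

@[simp] lemma comp_dart (M : CubicMap V) (C : M.Component) : M.comp (M.dart C).1 = C :=
  Quot.out_eq C

lemma dart_ne_inv_dart (M : CubicMap V) (C D : M.Component) : M.dart C ≠ M.inv (M.dart D) := by
  intro h
  have h2 : C = D := by rw [← M.comp_dart C, h, comp_inv, comp_dart]
  subst h2
  exact M.inv_ne _ h.symm

open scoped Classical in
/-- Cut the chosen edge of each component and join the ends cyclically. -/
noncomputable def merge (M : CubicMap V) (π : Equiv.Perm M.Component) : CubicMap V where
  inv d :=
    -- The far half of the edge cut in `C` is joined to the near half of the one cut in `π C`.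
    if d = M.dart (M.comp d.1) then M.inv (M.dart (π.symm (M.comp d.1)))
    else if d = M.inv (M.dart (M.comp d.1)) then M.dart (π (M.comp d.1))
    else M.inv d
  inv_inv d := by
    by_cases h1 : d = M.dart (M.comp d.1)
    · rw [if_pos h1]
      generalize M.comp d.1 = C at h1
      subst h1
      simp [comp_inv, (M.dart_ne_inv_dart _ _).symm]
    · rw [if_neg h1]
      by_cases h2 : d = M.inv (M.dart (M.comp d.1))
      · rw [if_pos h2]
        generalize M.comp d.1 = C at h2
        subst h2
        simp
      · rw [if_neg h2, comp_inv, if_neg (fun h => h2 (by rw [← h, M.inv_inv])),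
          if_neg (fun h => h1 (M.inv_injective h)), M.inv_inv]
  fst_inv_ne d := by
    by_cases h1 : d = M.dart (M.comp d.1)
    · rw [if_pos h1]
      generalize M.comp d.1 = C at h1
      subst h1
      intro h
      have h2 := congrArg M.comp h
      rw [comp_inv, comp_dart, comp_dart] at h2
      rw [h2] at h
      exact M.fst_inv_ne _ h
    · rw [if_neg h1]
      by_cases h2 : d = M.inv (M.dart (M.comp d.1))
      · rw [if_pos h2]
        generalize M.comp d.1 = C at h2
        subst h2
        intro h
        have h2 := congrArg M.comp h
        rw [comp_inv, comp_dart, comp_dart] at h2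
        rw [h2] at h
        exact M.fst_inv_ne _ h.symm
      · rw [if_neg h2]
        exact M.fst_inv_ne d

lemma merge_inv_dart (M : CubicMap V) (π : Equiv.Perm M.Component) (C : M.Component) :
    (M.merge π).inv (M.dart C) = M.inv (M.dart (π.symm C)) := by
  simp [merge]

lemma merge_inv_inv_dart (M : CubicMap V) (π : Equiv.Perm M.Component) (C : M.Component) :
    (M.merge π).inv (M.inv (M.dart C)) = M.dart (π C) := by
  simp [merge, comp_inv, (M.dart_ne_inv_dart _ _).symm]

lemma merge_inv_of_ne (M : CubicMap V) (π : Equiv.Perm M.Component) {d : V × Fin 3}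
    (h1 : ∀ C, d ≠ M.dart C) (h2 : ∀ C, d ≠ M.inv (M.dart C)) :
    (M.merge π).inv d = M.inv d := by
  simp [merge, h1, h2]

/-- The values on a component sum to zero, and all cancel in pairs except those on the two halves of
its cut edge, which are therefore opposite as well. -/
lemma IsFlow.of_merge [Finite V] {A : Type} [AddCommGroup A] {M : CubicMap V}
    {π : Equiv.Perm M.Component} {S : Set A} {f : V × Fin 3 → A} (hf : (M.merge π).IsFlow S f) :
    M.IsFlow S f := by
  classical
  have := Fintype.ofFinite V
  refine ⟨?_, hf.conserve, hf.mem⟩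
  have off : ∀ d, (∀ C, d ≠ M.dart C) → (∀ C, d ≠ M.inv (M.dart C)) → f (M.inv d) = -f d :=
    fun d h1 h2 => by rw [← M.merge_inv_of_ne π h1 h2, hf.antisymm]
  have key : ∀ C, f (M.inv (M.dart C)) = -f (M.dart C) := by
    intro C
    let s : Finset (V × Fin 3) := Finset.univ.filter fun d => M.comp d.1 = C
    have h0 : ∑ d ∈ s, f d = 0 := hf.sum_fst_mem_eq_zero {v | M.comp v = C}
    have m1 : M.dart C ∈ s := by simp [s]
    have m2 : M.inv (M.dart C) ∈ s.erase (M.dart C) := by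
      simp [s, comp_inv, (M.dart_ne_inv_dart _ _).symm]
    rw [← Finset.add_sum_erase _ _ m1, ← Finset.add_sum_erase _ _ m2,
      M.sum_eq_zero_of_closed f, add_zero] at h0
    · exact (neg_eq_of_add_eq_zero_right h0).symm
    · intro d hd
      simp only [s, Finset.mem_erase, Finset.mem_filter, Finset.mem_univ, true_and, ne_eq,
        comp_inv] at hd ⊢
      exact ⟨fun h => hd.2.1 (M.inv_injective h),
        fun h => hd.1 (by rw [← h, M.inv_inv]), hd.2.2⟩
    · intro d hd
      simp only [s, Finset.mem_erase, Finset.mem_filter, Finset.mem_univ, true_and, ne_eq] at hd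
      obtain ⟨h1, h2, h3⟩ := hd
      refine off d (fun D h => ?_) (fun D h => ?_)
      · have : D = C := by rw [← h3, h, comp_dart]
        exact h2 (this ▸ h)
      · have : D = C := by rw [← h3, h, comp_inv, comp_dart]
        exact h1 (this ▸ h)
  intro d
  by_cases h1 : ∃ C, d = M.dart C
  · obtain ⟨C, rfl⟩ := h1
    exact key C
  by_cases h2 : ∃ C, d = M.inv (M.dart C)
  · obtain ⟨C, rfl⟩ := h2
    rw [key, M.inv_inv, neg_neg]
  · exact off d (by simpa using h1) (by simpa using h2)

/-- A nowhere-zero real flow may be rescaled on each component separately so that all cut edges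
carry the same value; it is then a flow on the merged graph. -/
lemma Bridgeless.merge [Finite V] {M : CubicMap V} (hM : M.Bridgeless)
    (π : Equiv.Perm M.Component) : (M.merge π).Bridgeless := by
  classical
  have := Fintype.ofFinite V
  have : Finite M.Component := Finite.of_surjective M.comp Quot.mk_surjective
  have := Fintype.ofFinite M.Component
  obtain ⟨f, hf⟩ := hM.exists_flow
  have h0 : ∀ d, f d ≠ 0 := hf.mem
  let P : ℝ := ∏ C, f (M.dart C)
  have hP : P ≠ 0 := Finset.prod_ne_zero_iff.2 fun C _ => h0 _
  let g : V × Fin 3 → ℝ := fun d => P / f (M.dart (M.comp d.1)) * f d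
  have hg1 : ∀ C, g (M.dart C) = P := fun C => by
    simp only [g, comp_dart]
    exact div_mul_cancel₀ _ (h0 _)
  have hg2 : ∀ d, g (M.inv d) = -g d := fun d => by
    simp only [g, comp_inv, hf.antisymm, mul_neg]
  have hg : (M.merge π).IsFlow {0}ᶜ g := by
    refine ⟨fun d => ?_, fun v => ?_, fun d => ?_⟩
    · by_cases h1 : ∃ C, d = M.dart C
      · obtain ⟨C, rfl⟩ := h1
        rw [merge_inv_dart, hg2, hg1, hg1]
      by_cases h2 : ∃ C, d = M.inv (M.dart C)
      · obtain ⟨C, rfl⟩ := h2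
        rw [merge_inv_inv_dart, hg2, hg1, hg1, neg_neg]
      · rw [merge_inv_of_ne _ _ (by simpa using h1) (by simpa using h2), hg2]
    · simp only [g, ← Finset.mul_sum, hf.conserve, mul_zero]
    · exact mul_ne_zero (div_ne_zero hP (h0 _)) (h0 _)
  exact hg.bridgeless (by simp)

/-- Within a component, a closed set of the merged graph could be left only through the cut edge,
which is not a bridge. So it is a union of components, and `π` carries it through all of them. -/
lemma Bridgeless.connected_merge {M : CubicMap V} (hM : M.Bridgeless)
    {π : Equiv.Perm M.Component}
    (hπ : ∀ s : Set M.Component, s.Nonempty → (∀ C ∈ s, π C ∈ s) → ∀ C, C ∈ s) :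
    (M.merge π).Connected := by
  rintro X ⟨v₀, hv₀⟩ hX
  have off : ∀ d, (∀ C, d ≠ M.dart C) → (∀ C, d ≠ M.inv (M.dart C)) → d.1 ∈ X →
      (M.inv d).1 ∈ X := fun d h1 h2 h => by
    rw [← M.merge_inv_of_ne π h1 h2]
    exact hX d h
  have offC : ∀ C e, e ≠ M.dart C → e ≠ M.inv (M.dart C) → e.1 ∈ X ∩ {v | M.comp v = C} →
      (M.inv e).1 ∈ X ∩ {v | M.comp v = C} := by
    rintro C e h1 h2 ⟨h3, h4 : M.comp e.1 = C⟩
    refine ⟨off e (fun D h => ?_) (fun D h => ?_) h3, by rwa [Set.mem_ofPred_eq, comp_inv]⟩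
    · have : D = C := by rw [← h4, h, comp_dart]
      exact h1 (this ▸ h)
    · have : D = C := by rw [← h4, h, comp_inv, comp_dart]
      exact h2 (this ▸ h)
  have closed : ∀ d, d.1 ∈ X → (M.inv d).1 ∈ X := by
    intro d hd
    by_cases h1 : ∃ C, d = M.dart C
    · obtain ⟨C, rfl⟩ := h1
      exact (hM (M.dart C) (X ∩ {v | M.comp v = C}) ⟨hd, by simp⟩ (offC C)).1
    by_cases h2 : ∃ C, d = M.inv (M.dart C)
    · obtain ⟨C, rfl⟩ := h2
      refine (hM (M.inv (M.dart C)) (X ∩ {v | M.comp v = C}) ⟨hd, by simp [comp_inv]⟩ ?_).1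
      intro e h3 h4
      rw [M.inv_inv] at h4
      exact offC C e h4 h3
    · exact off d (by simpa using h1) (by simpa using h2) hd
  have all : ∀ C, (M.dart C).1 ∈ X := by
    refine hπ {C | (M.dart C).1 ∈ X} ⟨M.comp v₀, M.mem_of_comp_eq closed (by simp) hv₀⟩ ?_
    intro C hC
    have := hX (M.inv (M.dart C)) (closed _ hC)
    rwa [merge_inv_inv_dart] at this
  exact fun v => M.mem_of_comp_eq closed (by simp) (all (M.comp v))

/-- Adding `1` in `ZMod (card K)` is a single cycle. -/
lemma exists_perm_transitive (K : Type) [Finite K] [Nonempty K] : ∃ π : Equiv.Perm K,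
    ∀ s : Set K, s.Nonempty → (∀ C ∈ s, π C ∈ s) → ∀ C, C ∈ s := by
  have := Fintype.ofFinite K
  have : NeZero (Fintype.card K) := ⟨Fintype.card_ne_zero⟩
  let e : K ≃ ZMod (Fintype.card K) := Fintype.equivOfCardEq (ZMod.card _).symm
  refine ⟨(e.trans (Equiv.addRight 1)).trans e.symm, ?_⟩
  rintro s ⟨C₀, h₀⟩ hs C
  have key : ∀ n : ℕ, e.symm (e C₀ + n) ∈ s := by
    intro n
    induction n with
    | zero => simpa using h₀
    | succ n ih => simpa [add_assoc] using hs _ ih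
  obtain ⟨n, hn⟩ := ZMod.natCast_zmod_surjective (e C - e C₀)
  simpa [hn] using key n

/-- A bridgeless cubic graph can be made connected without creating new flows. -/
lemma Bridgeless.exists_connected [Finite V] [Nonempty V] {M : CubicMap V} (hM : M.Bridgeless) :
    ∃ M' : CubicMap V, M'.Bridgeless ∧ M'.Connected ∧
      ∀ (A : Type) [AddCommGroup A] (S : Set A) (f : V × Fin 3 → A),
        M'.IsFlow S f → M.IsFlow S f := by
  have : Finite M.Component := Finite.of_surjective M.comp Quot.mk_surjective
  have : Nonempty M.Component := ⟨M.comp (Classical.arbitrary V)⟩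
  obtain ⟨π, hπ⟩ := exists_perm_transitive M.Component
  exact ⟨M.merge π, hM.merge π, hM.connected_merge hπ, fun A _ S f hf => hf.of_merge⟩

end CubicMap
-- A spanning tree avoiding an edge at the root
/-- A cubic graph with a root and a spanning tree in which `(v, 0)` is the half-edge at `v`
towards its parent. The half-edge `(root, 0)` lies on no edge of the tree. -/
structure RootedCubicMap (V : Type) extends CubicMap V where
  root : V
  depth : V → ℕ
  depth_root : depth root = 0
  -- No edge leads to the parent from both ends; at `v = root`, the extra edge is not the parent
  -- edge of its other end.
  snd_inv_up : ∀ v, (inv (v, 0)).2 ≠ 0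
  depth_parent : ∀ v, v ≠ root → depth (inv (v, 0)).1 + 1 = depth v

namespace CubicMap

variable {V : Type}

/-- The simple graph underlying the graph without the edge of the half-edge `d`. -/
def removeEdge (M : CubicMap V) (d : V × Fin 3) : SimpleGraph V where
  Adj v w := ∃ e, e ≠ d ∧ e ≠ M.inv d ∧ e.1 = v ∧ (M.inv e).1 = w
  symm := ⟨by
    rintro v w ⟨e, h1, h2, h3, h4⟩
    exact ⟨M.inv e, fun h => h2 (M.inv_eq_iff.1 h), fun h => h1 (M.inv_injective h), h4,
      by rwa [M.inv_inv]⟩⟩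
  loopless := ⟨by
    rintro v ⟨e, -, -, h3, h4⟩
    exact M.fst_inv_ne e (h4.trans h3.symm)⟩

lemma Bridgeless.removeEdge_reachable {M : CubicMap V} (hM : M.Bridgeless) (hc : M.Connected)
    (d : V × Fin 3) (v : V) : (M.removeEdge d).Reachable d.1 v := by
  let X : Set V := {v | (M.removeEdge d).Reachable d.1 v}
  have hX : ∀ e, e ≠ d → e ≠ M.inv d → e.1 ∈ X → (M.inv e).1 ∈ X := fun e h1 h2 h3 =>
    SimpleGraph.Reachable.trans h3 (SimpleGraph.Adj.reachable ⟨e, h1, h2, rfl, rfl⟩)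
  have hd : d.1 ∈ X := SimpleGraph.Reachable.refl _
  refine hc X ⟨_, hd⟩ (fun e he => ?_) v
  by_cases h1 : e = d
  · subst h1
    exact hM e X hd hX
  by_cases h2 : e = M.inv d
  · subst h2
    rwa [M.inv_inv]
  · exact hX e h1 h2 he

lemma exists_adj_dist {G : SimpleGraph V} {a v : V} (h : G.Reachable a v) (hv : v ≠ a) :
    ∃ w, G.Adj v w ∧ G.dist a w + 1 = G.dist a v := by
  obtain ⟨p, hp⟩ := h.symm.exists_walk_length_eq_dist
  cases p with
  | nil => exact absurd rfl hv
  | @cons _ w _ hw p =>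
    refine ⟨w, hw, ?_⟩
    have h1 := G.dist_le p
    obtain ⟨q, hq⟩ := p.reachable.exists_walk_length_eq_dist
    have h2 := G.dist_le (SimpleGraph.Walk.cons hw q)
    simp only [SimpleGraph.Walk.length_cons] at hp h2
    rw [G.dist_comm (u := a), G.dist_comm (u := a)]
    omega

/-- A breadth-first tree of the graph without the edge of `(a, 0)`, still connected since that edge
is no bridge. The omission frees a half-edge at the root, later joined to the root of the rotation
graph. -/
lemma Bridgeless.exists_rooted [Nonempty V] {M : CubicMap V} (hM : M.Bridgeless)
    (hc : M.Connected) : ∃ (R : RootedCubicMap V) (π : V → Equiv.Perm (Fin 3)),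
      R.toCubicMap = M.relabel π := by
  classical
  let a : V := Classical.arbitrary V
  let H := M.removeEdge (a, 0)
  have key : ∀ v, ∃ i, (v = a → i = 0) ∧ (v ≠ a → (v, i) ≠ M.inv (a, 0) ∧
      H.dist a (M.inv (v, i)).1 + 1 = H.dist a v) := by
    intro v
    by_cases hv : v = a
    · exact ⟨0, fun _ => rfl, fun h => absurd hv h⟩
    · obtain ⟨w, ⟨⟨u, i⟩, h1, h2, rfl, rfl⟩, hd⟩ :=
        exists_adj_dist (hM.removeEdge_reachable hc (a, 0) v) hv
      exact ⟨i, fun h => absurd h hv, fun _ => ⟨h2, hd⟩⟩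
  choose up h0 hup using key
  let π : V → Equiv.Perm (Fin 3) := fun v => Equiv.swap 0 (up v)
  have hπ : ∀ v, π v 0 = up v := fun v => Equiv.swap_apply_left _ _
  refine ⟨⟨M.relabel π, a, H.dist a, H.dist_self, fun v => ?_, fun v hv => ?_⟩, π, rfl⟩
  · change (π (M.inv (v, π v 0)).1).symm (M.inv (v, π v 0)).2 ≠ 0
    rw [hπ, ne_eq, Equiv.symm_apply_eq, hπ]
    obtain ⟨⟨w, k⟩, hw⟩ : ∃ x, x = M.inv (v, up v) := ⟨_, rfl⟩
    have hw' : M.inv (w, k) = (v, up v) := by rw [hw, M.inv_inv]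
    rw [← hw]
    change k ≠ up w
    -- Otherwise the edge would be selected at both ends. The distances forbid this away from `a`;
    -- if one end is `a`, it would be the removed edge.
    rintro rfl
    by_cases hv : v = a
    · by_cases hwa : w = a
      · exact M.fst_inv_ne (v, up v) (by rw [← hw, hv, hwa])
      · exact (hup w hwa).1 (by rw [hw, h0 v hv, hv])
    · by_cases hwa : w = a
      · exact (hup v hv).1 (by rw [← hw', h0 w hwa, hwa])
      · have h1 := (hup v hv).2
        have h2 := (hup w hwa).2
        rw [← hw] at h1
        rw [hw'] at h2
        simp only at h1 h2
        omega
  · change H.dist a (M.inv (v, π v 0)).1 + 1 = H.dist a v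
    rw [hπ]
    exact (hup v hv).2

end CubicMap

/-! ### Construction of the rotation graph -/

namespace RootedCubicMap

variable {V : Type} (R : RootedCubicMap V) (B : ℕ)

/-- The half-edges at which a binary tree is attached: those which are not on an edge of the
spanning tree, except for `(root, 0)`. -/
def IsStub (d : V × Fin 3) : Prop :=
  d.2 ≠ 0 ∧ ((R.inv d).2 ≠ 0 ∨ d = R.inv (R.root, 0))

/-- The number of leaves of the binary tree attached at `d`. -/
def size (d : V × Fin 3) : ℕ := 2 ^ (B + 1 - R.depth d.1)

lemma size_pos (d : V × Fin 3) : 0 < R.size B d := by simp [size]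

/-- The nodes of the binary trees; the children of the node `n` are `2 * n` and `2 * n + 1`. -/
def Node : Type :=
  {p : (V × Fin 3) × ℕ // R.IsStub p.1 ∧ 1 ≤ p.2 ∧ p.2 < 2 * R.size B p.1}

/-- The vertices of the rotation graph: a root, and three copies of the given graph and of the
binary trees attached to it. -/
abbrev RotVertex : Type := Option (Fin 3 × (V ⊕ R.Node B))

variable {R B}

/-- The copy of `v` in the branch `j`. -/
abbrev base (j : Fin 3) (v : V) : R.RotVertex B := some (j, Sum.inl v)

/-- The node `n` of the tree attached at `d` in the branch `j`. -/
def node (j : Fin 3) (d : V × Fin 3) (n : ℕ)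
    (h : R.IsStub d ∧ 1 ≤ n ∧ n < 2 * R.size B d) : R.RotVertex B :=
  some (j, Sum.inr ⟨(d, n), h⟩)

@[simp] lemma node_inj {j j' : Fin 3} {d d' : V × Fin 3} {n n' : ℕ}
    {h : R.IsStub d ∧ 1 ≤ n ∧ n < 2 * R.size B d}
    {h' : R.IsStub d' ∧ 1 ≤ n' ∧ n' < 2 * R.size B d'} :
    node j d n h = node j' d' n' h' ↔ j = j' ∧ d = d' ∧ n = n' := by
  constructor
  · intro e
    obtain ⟨h1, h2⟩ := Prod.mk.inj (Option.some.inj e)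
    exact ⟨h1, Prod.mk.inj (congrArg Subtype.val (Sum.inr_injective h2))⟩
  · rintro ⟨rfl, rfl, rfl⟩
    rfl

@[simp] lemma node_ne_base {j j' : Fin 3} {d : V × Fin 3} {n : ℕ}
    {h : R.IsStub d ∧ 1 ≤ n ∧ n < 2 * R.size B d} {v : V} : node j d n h ≠ base j' v := by
  simp [node]

@[simp] lemma base_ne_node {j j' : Fin 3} {d : V × Fin 3} {n : ℕ}
    {h : R.IsStub d ∧ 1 ≤ n ∧ n < 2 * R.size B d} {v : V} : base j' v ≠ node j d n h := by
  simp [node]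

@[simp] lemma node_ne_none {j : Fin 3} {d : V × Fin 3} {n : ℕ}
    {h : R.IsStub d ∧ 1 ≤ n ∧ n < 2 * R.size B d} : node j d n h ≠ none := by
  simp [node]

@[simp] lemma none_ne_node {j : Fin 3} {d : V × Fin 3} {n : ℕ}
    {h : R.IsStub d ∧ 1 ≤ n ∧ n < 2 * R.size B d} : none ≠ node j d n h := by
  simp [node]

lemma rotVertex_cases {P : R.RotVertex B → Prop} (h0 : P none) (h1 : ∀ j v, P (base j v))
    (h2 : ∀ j d n h, P (node j d n h)) : ∀ x, P x
  | none => h0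
  | some (j, Sum.inl v) => h1 j v
  | some (j, Sum.inr ⟨(d, n), h⟩) => h2 j d n h

lemma isStub_inv_root : R.IsStub (R.inv (R.root, 0)) := ⟨R.snd_inv_up _, Or.inr rfl⟩

lemma IsStub.inv {d : V × Fin 3} (h : R.IsStub d) (hd : d ≠ R.inv (R.root, 0)) :
    R.IsStub (R.inv d) := by
  rcases h.2 with h2 | h2
  · exact ⟨h2, Or.inl (by rw [R.inv_inv]; exact h.1)⟩
  · exact absurd h2 hd

lemma IsStub.inv_ne_inv_root {d : V × Fin 3} (h : R.IsStub d) :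
    R.inv d ≠ R.inv (R.root, 0) := fun h' => h.1 (by rw [R.inv_injective h'])

lemma IsStub.ne_root {d : V × Fin 3} (h : R.IsStub d) : d ≠ (R.root, 0) := fun h' =>
  h.1 (by rw [h'])

lemma not_isStub_inv {d : V × Fin 3} (h : ¬ R.IsStub d) (hd : d ≠ (R.root, 0)) :
    ¬ R.IsStub (R.inv d) := by
  rintro ⟨h1, h2⟩
  rw [R.inv_inv] at h2
  rcases h2 with h2 | h2
  · exact h ⟨h2, Or.inl h1⟩
  · exact hd (R.inv_injective h2)

lemma inv_ne_root {d : V × Fin 3} (h : ¬ R.IsStub d) : R.inv d ≠ (R.root, 0) := fun h' =>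
  h (by rw [R.inv_eq_iff.1 h']; exact isStub_inv_root)

lemma snd_inv_of_not_isStub {d : V × Fin 3} (h : ¬ R.IsStub d) (hd : d.2 ≠ 0) :
    (R.inv d).2 = 0 := by
  by_contra h'
  exact h ⟨hd, Or.inl h'⟩

variable (R B)

open scoped Classical in
/-- The other half of an edge of the rotation graph. -/
noncomputable def rotInv : R.RotVertex B × Fin 3 → R.RotVertex B × Fin 3
  | (none, i) => (base i R.root, 0)
  | (some (j, Sum.inl v), i) =>
      if (v, i) = (R.root, 0) then (none, j)
      else if h : R.IsStub (v, i) then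
        (node j (v, i) 1 ⟨h, le_rfl, by have := R.size_pos B (v, i); omega⟩, 0)
      else (base j (R.inv (v, i)).1, (R.inv (v, i)).2)
  | (some (j, Sum.inr ⟨(d, n), h⟩), i) =>
      -- At a node, `0` points to the parent; `1` and `2` point to the children, or at a leaf to the
      -- next and the previous leaf of its cycle.
      if i = 0 then
        if hn : n = 1 then (base j d.1, d.2)
        else (node j d (n / 2) ⟨h.1, by have := h.2; simp only at this; omega⟩,
          if n % 2 = 0 then 1 else 2)
      else if hn : n < R.size B d then
        (node j d (2 * n + if i = 1 then 0 else 1)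
          ⟨h.1, by have := h.2; simp only at this; split_ifs <;> omega⟩, 0)
      else if i = 1 then
        if hn' : n + 1 < 2 * R.size B d then
          (node j d (n + 1) ⟨h.1, by omega, hn'⟩, 2)
        -- This tree has no partner in its branch, because `(root, 0)` goes to the common root; its
        -- cycle continues in the next branch.
        else if hd : d = R.inv (R.root, 0) then
          (node (j + 1) d (R.size B d) ⟨h.1, by have := R.size_pos B d; omega⟩, 2)
        else (node j (R.inv d) (R.size B (R.inv d))
          ⟨h.1.inv hd, by have := R.size_pos B (R.inv d); omega⟩, 2)
      else
        if hn' : R.size B d < n then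
          (node j d (n - 1) ⟨h.1, by have := h.2; simp only at this; omega⟩, 1)
        else if hd : d = R.inv (R.root, 0) then
          (node (j - 1) d (2 * R.size B d - 1) ⟨h.1, by have := R.size_pos B d; omega⟩, 1)
        else (node j (R.inv d) (2 * R.size B (R.inv d) - 1)
          ⟨h.1.inv hd, by have := R.size_pos B (R.inv d); omega⟩, 1)

variable {R B}

section

variable {j : Fin 3} {d : V × Fin 3} {n m : ℕ} {h : R.IsStub d ∧ 1 ≤ n ∧ n < 2 * R.size B d}

lemma rotInv_none (i : Fin 3) : R.rotInv B (none, i) = (base i R.root, 0) := rfl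

lemma rotInv_root : R.rotInv B (base j R.root, 0) = (none, j) := if_pos rfl

lemma rotInv_stub (hd : R.IsStub d) (h' : R.IsStub d ∧ 1 ≤ 1 ∧ 1 < 2 * R.size B d) :
    R.rotInv B (base j d.1, d.2) = (node j d 1 h', 0) := by
  have := hd.ne_root
  simp only [rotInv]
  rw [if_neg this, dif_pos hd]

lemma rotInv_tree (hd : ¬ R.IsStub d) (h0 : d ≠ (R.root, 0)) :
    R.rotInv B (base j d.1, d.2) = (base j (R.inv d).1, (R.inv d).2) := by
  simp only [rotInv]
  rw [if_neg h0, dif_neg hd]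

lemma rotInv_node_one {h : R.IsStub d ∧ 1 ≤ 1 ∧ 1 < 2 * R.size B d} :
    R.rotInv B (node j d 1 h, 0) = (base j d.1, d.2) := by
  simp [rotInv, node]

lemma rotInv_node_even (hm : n = 2 * m) (h' : R.IsStub d ∧ 1 ≤ m ∧ m < 2 * R.size B d) :
    R.rotInv B (node j d n h, 0) = (node j d m h', 1) := by
  subst hm
  rw [node]
  simp only [rotInv]
  rw [if_pos trivial, dif_neg (by omega), if_pos (by omega)]
  simp

lemma rotInv_node_odd (hm : n = 2 * m + 1) (h' : R.IsStub d ∧ 1 ≤ m ∧ m < 2 * R.size B d) :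
    R.rotInv B (node j d n h, 0) = (node j d m h', 2) := by
  subst hm
  rw [node]
  simp only [rotInv]
  rw [if_pos trivial, dif_neg (by omega), if_neg (by omega)]
  simp
  omega

lemma rotInv_left (hn : n < R.size B d)
    (h' : R.IsStub d ∧ 1 ≤ 2 * n ∧ 2 * n < 2 * R.size B d) :
    R.rotInv B (node j d n h, 1) = (node j d (2 * n) h', 0) := by
  rw [node]
  simp only [rotInv]
  rw [if_neg (by decide), dif_pos hn]
  simp

lemma rotInv_right (hn : n < R.size B d)
    (h' : R.IsStub d ∧ 1 ≤ 2 * n + 1 ∧ 2 * n + 1 < 2 * R.size B d) :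
    R.rotInv B (node j d n h, 2) = (node j d (2 * n + 1) h', 0) := by
  rw [node]
  simp only [rotInv]
  rw [if_neg (by decide), dif_pos hn]
  simp

lemma rotInv_next (hn : R.size B d ≤ n)
    (h' : R.IsStub d ∧ 1 ≤ n + 1 ∧ n + 1 < 2 * R.size B d) :
    R.rotInv B (node j d n h, 1) = (node j d (n + 1) h', 2) := by
  rw [node]
  simp only [rotInv]
  rw [if_neg (by decide), dif_neg (by omega), if_pos trivial, dif_pos h'.2.2]

lemma rotInv_last_root (hn : n + 1 = 2 * R.size B d) (hd : d = R.inv (R.root, 0))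
    (h' : R.IsStub d ∧ 1 ≤ R.size B d ∧ R.size B d < 2 * R.size B d) :
    R.rotInv B (node j d n h, 1) = (node (j + 1) d (R.size B d) h', 2) := by
  rw [node]
  simp only [rotInv]
  rw [if_neg (by decide), dif_neg (by omega), if_pos trivial, dif_neg (by omega), dif_pos hd]

lemma rotInv_last (hn : n + 1 = 2 * R.size B d) (hd : d ≠ R.inv (R.root, 0))
    (h' : R.IsStub (R.inv d) ∧ 1 ≤ R.size B (R.inv d) ∧
      R.size B (R.inv d) < 2 * R.size B (R.inv d)) :
    R.rotInv B (node j d n h, 1) = (node j (R.inv d) (R.size B (R.inv d)) h', 2) := by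
  rw [node]
  simp only [rotInv]
  rw [if_neg (by decide), dif_neg (by omega), if_pos trivial, dif_neg (by omega), dif_neg hd]

lemma rotInv_prev (hn : R.size B d < n)
    (h' : R.IsStub d ∧ 1 ≤ n - 1 ∧ n - 1 < 2 * R.size B d) :
    R.rotInv B (node j d n h, 2) = (node j d (n - 1) h', 1) := by
  rw [node]
  simp only [rotInv]
  rw [if_neg (by decide), dif_neg (by omega), if_neg (by decide), dif_pos hn]

lemma rotInv_first_root (hn : n = R.size B d) (hd : d = R.inv (R.root, 0))
    (h' : R.IsStub d ∧ 1 ≤ 2 * R.size B d - 1 ∧ 2 * R.size B d - 1 < 2 * R.size B d) :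
    R.rotInv B (node j d n h, 2) = (node (j - 1) d (2 * R.size B d - 1) h', 1) := by
  rw [node]
  simp only [rotInv]
  rw [if_neg (by decide), dif_neg (by omega), if_neg (by decide), dif_neg (by omega),
    dif_pos hd]

lemma rotInv_first (hn : n = R.size B d) (hd : d ≠ R.inv (R.root, 0))
    (h' : R.IsStub (R.inv d) ∧ 1 ≤ 2 * R.size B (R.inv d) - 1 ∧
      2 * R.size B (R.inv d) - 1 < 2 * R.size B (R.inv d)) :
    R.rotInv B (node j d n h, 2) =
      (node j (R.inv d) (2 * R.size B (R.inv d) - 1) h', 1) := by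
  rw [node]
  simp only [rotInv]
  rw [if_neg (by decide), dif_neg (by omega), if_neg (by decide), dif_neg (by omega),
    dif_neg hd]

end

/-- Case distinction for the half-edges of the rotation graph. -/
lemma rotInv_cases {P : R.RotVertex B × Fin 3 → R.RotVertex B × Fin 3 → Prop}
    (symm : ∀ x y, P x y → P y x)
    (root : ∀ j, P (base j R.root, 0) (none, j))
    (tree : ∀ j v, v ≠ R.root → P (base j v, 0) (base j (R.inv (v, 0)).1, (R.inv (v, 0)).2))
    (stub : ∀ j d h, P (node j d 1 h, 0) (base j d.1, d.2))
    (left : ∀ j d n h h', n < R.size B d → P (node j d (2 * n) h, 0) (node j d n h', 1))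
    (right : ∀ j d n h h', n < R.size B d → P (node j d (2 * n + 1) h, 0) (node j d n h', 2))
    (next : ∀ j d n h h', R.size B d ≤ n → P (node j d n h, 1) (node j d (n + 1) h', 2))
    (last_root : ∀ j d n h h', n + 1 = 2 * R.size B d → d = R.inv (R.root, 0) →
      P (node j d n h, 1) (node (j + 1) d (R.size B d) h', 2))
    (last : ∀ j d n h h', n + 1 = 2 * R.size B d → d ≠ R.inv (R.root, 0) →
      P (node j d n h, 1) (node j (R.inv d) (R.size B (R.inv d)) h', 2)) :
    ∀ x, P x (R.rotInv B x) := by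
  rintro ⟨x, i⟩
  revert i
  refine rotVertex_cases (P := fun x => ∀ i, P (x, i) (R.rotInv B (x, i))) ?_ ?_ ?_ x
  · intro i
    exact symm _ _ (root i)
  · intro j v i
    by_cases h0 : (v, i) = (R.root, 0)
    · obtain ⟨rfl, rfl⟩ := Prod.mk.inj h0
      rw [rotInv_root]
      exact root j
    by_cases hs : R.IsStub (v, i)
    · have h1 : 1 < 2 * R.size B (v, i) := by have := R.size_pos B (v, i); omega
      rw [rotInv_stub (d := (v, i)) hs ⟨hs, le_rfl, h1⟩]
      exact symm _ _ (stub j (v, i) _)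
    · rw [rotInv_tree (d := (v, i)) hs h0]
      by_cases hi : i = 0
      · subst hi
        exact tree j v fun h => h0 (by rw [h])
      · have h2 := snd_inv_of_not_isStub hs hi
        have h3 := inv_ne_root hs
        obtain ⟨⟨w, k⟩, hw⟩ : ∃ y, y = R.inv (v, i) := ⟨_, rfl⟩
        have hw' : R.inv (w, k) = (v, i) := by rw [hw, R.inv_inv]
        rw [← hw] at h2 h3 ⊢
        obtain rfl : k = 0 := h2
        have := tree j w fun h => h3 (by rw [h])
        rw [hw'] at this
        exact symm _ _ this
  · intro j d n h i
    have hpos := R.size_pos B d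
    by_cases h0 : i = 0
    · subst h0
      by_cases hn : n = 1
      · subst hn
        rw [rotInv_node_one]
        exact stub j d _
      · rcases Nat.even_or_odd' n with ⟨m, rfl | rfl⟩
        · rw [rotInv_node_even (m := m) rfl ⟨h.1, by omega⟩]
          exact left j d m _ _ (by omega)
        · rw [rotInv_node_odd (m := m) rfl ⟨h.1, by omega⟩]
          exact right j d m _ _ (by omega)
    by_cases h1 : i = 1
    · subst h1
      by_cases hn : n < R.size B d
      · rw [rotInv_left hn ⟨h.1, by omega⟩]
        exact symm _ _ (left j d n _ _ hn)
      by_cases hn' : n + 1 < 2 * R.size B d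
      · rw [rotInv_next (by omega) ⟨h.1, by omega⟩]
        exact next j d n _ _ (by omega)
      by_cases hd : d = R.inv (R.root, 0)
      · rw [rotInv_last_root (by omega) hd ⟨h.1, by omega⟩]
        exact last_root j d n _ _ (by omega) hd
      · have := R.size_pos B (R.inv d)
        rw [rotInv_last (by omega) hd ⟨h.1.inv hd, by omega⟩]
        exact last j d n _ _ (by omega) hd
    · obtain rfl : i = 2 := by omega
      by_cases hn : n < R.size B d
      · rw [rotInv_right hn ⟨h.1, by omega⟩]
        exact symm _ _ (right j d n _ _ hn)
      by_cases hn' : R.size B d < n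
      · rw [rotInv_prev hn' ⟨h.1, by omega⟩]
        obtain ⟨m, rfl⟩ : ∃ m, n = m + 1 := ⟨n - 1, by omega⟩
        exact symm _ _ (next j d m _ _ (by omega))
      obtain rfl : n = R.size B d := by omega
      by_cases hd : d = R.inv (R.root, 0)
      · rw [rotInv_first_root rfl hd ⟨h.1, by omega⟩]
        have := last_root (j - 1) d (2 * R.size B d - 1) ⟨h.1, by omega⟩ h (by omega) hd
        simp only [sub_add_cancel] at this
        exact symm _ _ this
      · have hp := R.size_pos B (R.inv d)
        rw [rotInv_first rfl hd ⟨h.1.inv hd, by omega⟩]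
        have := last j (R.inv d) (2 * R.size B (R.inv d) - 1) ⟨h.1.inv hd, by omega⟩
          (by simpa using h) (by omega) h.1.inv_ne_inv_root
        simp only [R.inv_inv] at this
        exact symm _ _ this

variable (R B)

/-- The rotation graph of a rooted cubic graph. -/
noncomputable def rotation : CubicMap (R.RotVertex B) where
  inv := R.rotInv B
  inv_inv := by
    -- The trivial second conjunct provides the symmetric relation that `rotInv_cases` requires.
    suffices h : ∀ x, R.rotInv B (R.rotInv B x) = x ∧
        R.rotInv B x = R.rotInv B x from fun x => (h x).1
    refine rotInv_cases (P := fun x y => R.rotInv B y = x ∧ R.rotInv B x = y)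
      (fun x y h => h.symm) ?_ ?_ ?_ ?_ ?_ ?_ ?_ ?_
    · exact fun j => ⟨rotInv_none j, rotInv_root⟩
    · intro j v hv
      have h1 : ¬ R.IsStub (v, 0) := fun h => h.1 rfl
      have h2 : (v, (0 : Fin 3)) ≠ (R.root, 0) := fun h => hv (Prod.mk.inj h).1
      rw [rotInv_tree (not_isStub_inv h1 h2) (inv_ne_root h1), R.inv_inv]
      exact ⟨rfl, rotInv_tree h1 h2⟩
    · exact fun j d h => ⟨rotInv_stub h.1 h, rotInv_node_one⟩
    · exact fun j d n h h' hn => ⟨rotInv_left hn h, rotInv_node_even rfl h'⟩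
    · exact fun j d n h h' hn => ⟨rotInv_right hn h, rotInv_node_odd rfl h'⟩
    · exact fun j d n h h' hn => ⟨by rw [rotInv_prev (by omega) h]; rfl, rotInv_next hn h'⟩
    · intro j d n h h' hn hd
      rw [rotInv_first_root rfl hd ⟨h.1, by omega⟩, rotInv_last_root hn hd h']
      simp
      omega
    · intro j d n h h' hn hd
      have := R.size_pos B d
      rw [rotInv_first rfl h.1.inv_ne_inv_root (by rw [R.inv_inv]; exact ⟨h.1, by omega⟩),
        rotInv_last hn hd h']
      simp
      omega
  fst_inv_ne := by
    refine rotInv_cases (P := fun x y => y.1 ≠ x.1) (fun x y h => h.symm) ?_ ?_ ?_ ?_ ?_ ?_ ?_ ?_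
    · simp
    · intro j v hv
      have := R.fst_inv_ne (v, 0)
      simpa using this
    · simp
    · intro j d n h h' hn
      have := h'.2.1
      simp
      omega
    · intro j d n h h' hn
      simp
      omega
    · simp
    · simp
    · intro j d n h h' hn hd
      simp [R.inv_ne]

end RootedCubicMap
-- Small cuts
lemma CubicMap.Bridgeless.mem_iff {V : Type} {M : CubicMap V} (hM : M.Bridgeless) {d : V × Fin 3}
    {X : Set V} (hX : ∀ e, e ≠ d → e ≠ M.inv d → (e.1 ∈ X ↔ (M.inv e).1 ∈ X)) :
    d.1 ∈ X ↔ (M.inv d).1 ∈ X := by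
  refine ⟨fun h => hM d X h fun e h1 h2 => (hX e h1 h2).1, fun h => ?_⟩
  have := hM (M.inv d) X h fun e h1 h2 => (hX e (by rwa [M.inv_inv] at h2) h1).1
  rwa [M.inv_inv] at this

/-- Conservation over `X` across a two-edge cut. For flows, a gadget attached by two edges thus
behaves like a single edge. -/
lemma CubicMap.IsFlow.add_eq_zero_of_crossing {V A : Type} [Finite V] [AddCommGroup A]
    {M : CubicMap V} {S : Set A} {f : V × Fin 3 → A} (hf : M.IsFlow S f) (X : Set V)
    {d e : V × Fin 3} (hde : d ≠ e) (hd : d.1 ∈ X) (hd' : (M.inv d).1 ∉ X) (he : e.1 ∈ X)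
    (he' : (M.inv e).1 ∉ X) (hX : ∀ x, x ≠ d → x ≠ e → x.1 ∈ X → (M.inv x).1 ∈ X) :
    f d + f e = 0 := by
  classical
  have := Fintype.ofFinite V
  rw [← Finset.sum_pair hde, ← hf.sum_crossing X]
  refine Finset.sum_congr ?_ fun _ _ => rfl
  ext x
  simp only [Finset.mem_insert, Finset.mem_singleton, Finset.mem_filter, Finset.mem_univ,
    true_and]
  constructor
  · rintro (rfl | rfl)
    exacts [⟨hd, hd'⟩, ⟨he, he'⟩]
  · rintro ⟨h1, h2⟩
    by_contra! h
    exact h2 (hX x h.1 h.2 h1)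

/-! ### Levels, leaves and absence of parallel edges -/

namespace RootedCubicMap

variable {V : Type} {R : RootedCubicMap V} {B : ℕ}

instance [Finite V] : Finite (R.Node B) := by
  refine Finite.of_injective
    (β := (V × Fin 3) × Fin (2 * 2 ^ (B + 1)))
    (fun p => (p.1.1, ⟨p.1.2, p.2.2.2.trans_le ?_⟩)) ?_
  · exact Nat.mul_le_mul_left 2 (Nat.pow_le_pow_right (by norm_num) (Nat.sub_le _ _))
  · rintro ⟨⟨d, n⟩, h⟩ ⟨⟨d', n'⟩, h'⟩ e
    simp only [Prod.mk.injEq, Fin.mk.injEq] at e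
    exact Subtype.ext (Prod.ext e.1 e.2)

lemma inv_rotation : (R.rotation B).inv = R.rotInv B := rfl

/-- The depth of a vertex in the spanning tree of the rotation graph. -/
def level : R.RotVertex B → ℕ
  | none => 0
  | some (_, Sum.inl v) => R.depth v + 1
  | some (_, Sum.inr ⟨(d, n), _⟩) => R.depth d.1 + 2 + Nat.log 2 n

@[simp] lemma level_none : level (none : R.RotVertex B) = 0 := rfl

@[simp] lemma level_base (j : Fin 3) (v : V) :
    level (base j v : R.RotVertex B) = R.depth v + 1 := rfl

@[simp] lemma level_node (j : Fin 3) (d : V × Fin 3) (n : ℕ)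
    (h : R.IsStub d ∧ 1 ≤ n ∧ n < 2 * R.size B d) :
    level (node j d n h) = R.depth d.1 + 2 + Nat.log 2 n := rfl

/-- The leaves of the spanning tree of the rotation graph. -/
def IsLeaf : R.RotVertex B → Prop
  | none => False
  | some (_, Sum.inl _) => False
  | some (_, Sum.inr ⟨(d, n), _⟩) => R.size B d ≤ n

@[simp] lemma not_isLeaf_none : ¬ IsLeaf (none : R.RotVertex B) := id

@[simp] lemma not_isLeaf_base (j : Fin 3) (v : V) : ¬ IsLeaf (base j v : R.RotVertex B) := id

@[simp] lemma isLeaf_node (j : Fin 3) (d : V × Fin 3) (n : ℕ)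
    (h : R.IsStub d ∧ 1 ≤ n ∧ n < 2 * R.size B d) :
    IsLeaf (node j d n h) ↔ R.size B d ≤ n := Iff.rfl

/-- The exponent in `size` is the height of the attached tree and compensates for the depth of its
place of attachment; `hB` keeps the truncated subtraction exact. -/
lemma level_of_isLeaf (hB : ∀ v, R.depth v ≤ B) :
    ∀ x : R.RotVertex B, IsLeaf x → level x = B + 3 := by
  refine rotVertex_cases (by simp) (by simp) fun j d n h hn => ?_
  rw [isLeaf_node] at hn
  have h1 : Nat.log 2 n = B + 1 - R.depth d.1 := by
    refine Nat.log_eq_of_pow_le_of_lt_pow hn ?_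
    rw [pow_succ, mul_comm]
    exact h.2.2
  have := hB d.1
  rw [level_node, h1]
  omega

/-- `x` is the half-edge towards the parent and `y` its other half. -/
def IsTreeLink (x y : R.RotVertex B × Fin 3) : Prop :=
  x.1 ≠ none ∧ x.2 = 0 ∧ ¬ IsLeaf y.1 ∧ (y.1 = none ∨ y.2 ≠ 0) ∧ level y.1 + 1 = level x.1

/-- `x` and `y` belong to an edge of a cycle on the leaves. -/
def IsLeafLink (x y : R.RotVertex B × Fin 3) : Prop :=
  IsLeaf x.1 ∧ IsLeaf y.1 ∧ (x.2 = 1 ∧ y.2 = 2 ∨ x.2 = 2 ∧ y.2 = 1)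

/-- Every edge runs between a vertex and its parent or joins consecutive leaves of a cycle. -/
lemma link_cases : ∀ x : R.RotVertex B × Fin 3, IsTreeLink x (R.rotInv B x) ∨
    IsTreeLink (R.rotInv B x) x ∨ IsLeafLink x (R.rotInv B x) := by
  refine rotInv_cases (P := fun x y => IsTreeLink x y ∨ IsTreeLink y x ∨ IsLeafLink x y)
    ?_ ?_ ?_ ?_ ?_ ?_ ?_ ?_ ?_
  · rintro x y (h | h | ⟨h1, h2, h3⟩)
    · exact Or.inr (Or.inl h)
    · exact Or.inl h
    · exact Or.inr (Or.inr ⟨h2, h1, by tauto⟩)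
  · intro j
    simp [IsTreeLink, R.depth_root]
  · intro j v hv
    have := R.depth_parent v hv
    have := R.snd_inv_up v
    refine Or.inl ⟨by simp, rfl, by simp, Or.inr this, ?_⟩
    simp only [level_base]
    omega
  · intro j d h
    refine Or.inl ⟨by simp, rfl, by simp, Or.inr h.1.1, ?_⟩
    simp
  · intro j d n h h' hn
    refine Or.inl ⟨by simp, rfl, by simpa using hn, Or.inr (by simp), ?_⟩
    have := h'.2.1
    simp only [level_node]
    rw [Nat.log_of_one_lt_of_le (n := 2 * n) (by norm_num) (by omega),
      show 2 * n / 2 = n by omega]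
    omega
  · intro j d n h h' hn
    refine Or.inl ⟨by simp, rfl, by simpa using hn, Or.inr (by simp), ?_⟩
    have := h'.2.1
    simp only [level_node]
    rw [Nat.log_of_one_lt_of_le (n := 2 * n + 1) (by norm_num) (by omega),
      show (2 * n + 1) / 2 = n by omega]
    omega
  · intro j d n h h' hn
    exact Or.inr (Or.inr ⟨hn, by simp; omega, Or.inl ⟨rfl, rfl⟩⟩)
  · intro j d n h h' hn hd
    exact Or.inr (Or.inr ⟨by simp; omega, by simp, Or.inl ⟨rfl, rfl⟩⟩)
  · intro j d n h h' hn hd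
    exact Or.inr (Or.inr ⟨by simp; omega, by simp, Or.inl ⟨rfl, rfl⟩⟩)

lemma isTreeLink_up {x : R.RotVertex B} (hx : x ≠ none) :
    IsTreeLink (x, 0) (R.rotInv B (x, 0)) := by
  rcases link_cases (x, (0 : Fin 3)) with h | h | h
  · exact h
  · rcases h.2.2.2.1 with h1 | h1
    · exact absurd h1 hx
    · exact absurd rfl h1
  · have := h.2.2
    simp at this

/-- Each tree has at least two leaves, so each leaf cycle has at least four vertices. This is why
the exponent in `size` has `B + 1` and not `B`. -/
lemma next_ne_prev (hB : ∀ v, R.depth v ≤ B) (x : R.RotVertex B) (hx : IsLeaf x) :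
    (R.rotInv B (x, 1)).1 ≠ (R.rotInv B (x, 2)).1 := by
  revert hx
  refine rotVertex_cases (P := fun x => IsLeaf x →
    (R.rotInv B (x, 1)).1 ≠ (R.rotInv B (x, 2)).1) (by simp) (by simp) ?_ x
  intro j d n h hn
  rw [isLeaf_node] at hn
  have hs : ∀ e, 2 ≤ R.size B e := fun e => by
    have := hB e.1
    calc 2 = 2 ^ 1 := rfl
      _ ≤ R.size B e := Nat.pow_le_pow_right (by norm_num) (by omega)
  have h2 := hs d
  by_cases hd : d = R.inv (R.root, 0)
  · by_cases h1 : n + 1 < 2 * R.size B d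
    · rw [rotInv_next hn ⟨h.1, by omega⟩]
      by_cases h3 : R.size B d < n
      · rw [rotInv_prev h3 ⟨h.1, by omega⟩]
        simp
        omega
      · rw [rotInv_first_root (by omega) hd ⟨h.1, by omega⟩]
        have hj : ∀ j : Fin 3, j ≠ j - 1 := by decide
        simp [hj]
    · rw [rotInv_last_root (by omega) hd ⟨h.1, by omega⟩, rotInv_prev (by omega) ⟨h.1, by omega⟩]
      simp
  · have h4 := hs (R.inv d)
    have h5 := R.inv_ne d
    by_cases h1 : n + 1 < 2 * R.size B d
    · rw [rotInv_next hn ⟨h.1, by omega⟩]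
      by_cases h3 : R.size B d < n
      · rw [rotInv_prev h3 ⟨h.1, by omega⟩]
        simp
        omega
      · rw [rotInv_first (by omega) hd ⟨h.1.inv hd, by omega⟩]
        simp [h5.symm]
    · rw [rotInv_last (by omega) hd ⟨h.1.inv hd, by omega⟩,
        rotInv_prev (by omega) ⟨h.1, by omega⟩]
      simp [h5]

/-- Level and leaf status distinguish parent, children and cycle neighbours. Two edges to one child
would share its half-edge `0`; cycle neighbours differ by `next_ne_prev`. -/
lemma rotation_simple (hB : ∀ v, R.depth v ≤ B) (x : R.RotVertex B) :
    Function.Injective fun i => ((R.rotation B).inv (x, i)).1 := by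
  intro i k h
  change (R.rotInv B (x, i)).1 = (R.rotInv B (x, k)).1 at h
  have same : (R.rotInv B (x, i)).2 = (R.rotInv B (x, k)).2 → i = k := fun h' =>
    (Prod.mk.inj ((R.rotation B).inv_injective (Prod.ext h h'))).2
  have hl := congrArg level h
  rcases link_cases (x, i) with h1 | h1 | h1 <;> rcases link_cases (x, k) with h2 | h2 | h2
  · exact h1.2.1.trans h2.2.1.symm
  · have := h1.2.2.2.2
    have := h2.2.2.2.2
    simp only at *
    omega
  · exact absurd (h ▸ h2.2.1) h1.2.2.1
  · have := h1.2.2.2.2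
    have := h2.2.2.2.2
    simp only at *
    omega
  · exact same (h1.2.1.trans h2.2.1.symm)
  · exact absurd h2.1 h1.2.2.1
  · exact absurd (h ▸ h1.2.1) h2.2.2.1
  · exact absurd h1.1 h2.2.2.1
  · rcases h1.2.2 with ⟨h3, h4⟩ | ⟨h3, h4⟩ <;> rcases h2.2.2 with ⟨h5, h6⟩ | ⟨h5, h6⟩
    · exact h3.trans h5.symm
    · simp only at h3 h5
      subst h3 h5
      exact absurd h (next_ne_prev hB x h1.1)
    · simp only at h3 h5
      subst h3 h5
      exact absurd h.symm (next_ne_prev hB x h1.1)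
    · exact h3.trans h5.symm

/-! ### Flows -/

/-- The flow is read off in branch `0`. Conservation at vertices and along tree edges is inherited;
for each cut edge, opposite values at its halves come from a two-edge cut. -/
lemma isFlow_of_rotation [Finite V] {A : Type} [AddCommGroup A] {S : Set A}
    {f : R.RotVertex B × Fin 3 → A} (hf : (R.rotation B).IsFlow S f) :
    R.IsFlow S (fun d => f (base 0 d.1, d.2)) := by
  have stub_eq : ∀ d h, f (node 0 d 1 h, 0) = -f (base 0 d.1, d.2) := fun d h => by
    rw [← hf.antisymm, inv_rotation, rotInv_stub h.1 h]
  have key_root : f (base 0 R.root, 0) +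
      f (base 0 (R.inv (R.root, 0)).1, (R.inv (R.root, 0)).2) = 0 := by
    -- Branch `0` without its unpaired tree: only the edge to `none` and the edge to that tree leave
    -- it.
    let X : Set (R.RotVertex B) := {x | x.elim False fun p => p.1 = 0 ∧
      Sum.elim (fun _ => True) (fun q => q.1.1 ≠ R.inv (R.root, 0)) p.2}
    have m0 : none ∉ X := id
    have m1 : ∀ j v, base j v ∈ X ↔ j = 0 := fun j v => and_iff_left trivial
    have m2 : ∀ j d n h, node j d n h ∈ X ↔ j = 0 ∧ d ≠ R.inv (R.root, 0) :=
      fun j d n h => Iff.rfl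
    refine hf.add_eq_zero_of_crossing X ?_ ?_ ?_ ?_ ?_ ?_
    · intro h
      exact R.snd_inv_up R.root (Prod.mk.inj h).2.symm
    · exact (m1 _ _).2 rfl
    · rwa [inv_rotation, rotInv_root]
    · exact (m1 _ _).2 rfl
    · have := R.size_pos B (R.inv (R.root, 0))
      rw [inv_rotation, rotInv_stub isStub_inv_root ⟨isStub_inv_root, le_rfl, by omega⟩, m2]
      simp
    · intro x h1 h2
      -- The alternatives for `R.rotInv B x` give the symmetry needed by `rotInv_cases`; they are
      -- harmless because those half-edges start in `X`.
      suffices h : (x = (base 0 R.root, 0) ∨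
          x = (base 0 (R.inv (R.root, 0)).1, (R.inv (R.root, 0)).2)) ∨
          (R.rotInv B x = (base 0 R.root, 0) ∨
          R.rotInv B x = (base 0 (R.inv (R.root, 0)).1, (R.inv (R.root, 0)).2)) ∨
          (x.1 ∈ X ↔ (R.rotInv B x).1 ∈ X) by
        rcases h with h | h | h
        · tauto
        · intro h3
          rcases h with h | h
          · rw [inv_rotation, h]
            exact (m1 _ _).2 rfl
          · rw [inv_rotation, h]
            exact (m1 _ _).2 rfl
        · exact h.1
      clear h1 h2
      revert x
      refine rotInv_cases (P := fun x y => (x = (base 0 R.root, 0) ∨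
          x = (base 0 (R.inv (R.root, 0)).1, (R.inv (R.root, 0)).2)) ∨
          (y = (base 0 R.root, 0) ∨
          y = (base 0 (R.inv (R.root, 0)).1, (R.inv (R.root, 0)).2)) ∨
          (x.1 ∈ X ↔ y.1 ∈ X)) (fun x y h => by tauto) ?_ ?_ ?_ ?_ ?_ ?_ ?_ ?_
      · intro j
        by_cases hj : j = 0
        · exact Or.inl (Or.inl (by rw [hj]))
        · exact Or.inr (Or.inr (iff_of_false (mt (m1 _ _).1 hj) m0))
      · exact fun j v _ => Or.inr (Or.inr ((m1 _ _).trans (m1 _ _).symm))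
      · intro j d h
        by_cases hd : d = R.inv (R.root, 0)
        · by_cases hj : j = 0
          · exact Or.inr (Or.inl (Or.inr (by rw [hj, hd])))
          · exact Or.inr (Or.inr (by rw [m1, m2]; tauto))
        · exact Or.inr (Or.inr (by rw [m1, m2]; tauto))
      · exact fun j d n h h' _ => Or.inr (Or.inr ((m2 _ _ _ _).trans (m2 _ _ _ _).symm))
      · exact fun j d n h h' _ => Or.inr (Or.inr ((m2 _ _ _ _).trans (m2 _ _ _ _).symm))
      · exact fun j d n h h' _ => Or.inr (Or.inr ((m2 _ _ _ _).trans (m2 _ _ _ _).symm))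
      · intro j d n h h' _ hd
        exact Or.inr (Or.inr (by rw [m2, m2]; tauto))
      · intro j d n h h' _ hd
        have := h.1.inv_ne_inv_root
        exact Or.inr (Or.inr (by rw [m2, m2]; tauto))
  have key_stub : ∀ d, R.IsStub d → d ≠ R.inv (R.root, 0) →
      f (base 0 d.1, d.2) + f (base 0 (R.inv d).1, (R.inv d).2) = 0 := by
    intro d hd hd'
    have s1 := R.size_pos B d
    have s2 := R.size_pos B (R.inv d)
    have ne := hd.inv_ne_inv_root
    -- The nodes of the two trees that replace the edge of `d` in branch `0`; only the edges above
    -- their top nodes leave it.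
    let X : Set (R.RotVertex B) := {x | x.elim False fun p => p.1 = 0 ∧
      Sum.elim (fun _ => False) (fun q => q.1.1 = d ∨ q.1.1 = R.inv d) p.2}
    have m0 : none ∉ X := id
    have m1 : ∀ j v, base j v ∉ X := fun j v h => h.2
    have m2 : ∀ j e n h, node j e n h ∈ X ↔ j = 0 ∧ (e = d ∨ e = R.inv d) :=
      fun j e n h => Iff.rfl
    have h0 : f (node 0 d 1 ⟨hd, le_rfl, by omega⟩, 0) +
        f (node 0 (R.inv d) 1 ⟨hd.inv hd', le_rfl, by omega⟩, 0) = 0 := by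
      refine hf.add_eq_zero_of_crossing X ?_ ?_ ?_ ?_ ?_ ?_
      · simp [(R.inv_ne d).symm]
      · exact (m2 _ _ _ _).2 ⟨rfl, Or.inl rfl⟩
      · rw [inv_rotation, rotInv_node_one]
        exact m1 _ _
      · exact (m2 _ _ _ _).2 ⟨rfl, Or.inr rfl⟩
      · rw [inv_rotation, rotInv_node_one]
        exact m1 _ _
      · intro x h1 h2
        suffices h : (x = (node 0 d 1 ⟨hd, le_rfl, by omega⟩, 0) ∨
            x = (node 0 (R.inv d) 1 ⟨hd.inv hd', le_rfl, by omega⟩, 0)) ∨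
            (R.rotInv B x = (node 0 d 1 ⟨hd, le_rfl, by omega⟩, 0) ∨
            R.rotInv B x = (node 0 (R.inv d) 1 ⟨hd.inv hd', le_rfl, by omega⟩, 0)) ∨
            (x.1 ∈ X ↔ (R.rotInv B x).1 ∈ X) by
          rcases h with h | h | h
          · tauto
          · intro h3
            rcases h with h | h
            · rw [inv_rotation, h]
              exact (m2 _ _ _ _).2 ⟨rfl, Or.inl rfl⟩
            · rw [inv_rotation, h]
              exact (m2 _ _ _ _).2 ⟨rfl, Or.inr rfl⟩
          · exact h.1
        clear h1 h2
        revert x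
        refine rotInv_cases (P := fun x y => (x = (node 0 d 1 ⟨hd, le_rfl, by omega⟩, 0) ∨
            x = (node 0 (R.inv d) 1 ⟨hd.inv hd', le_rfl, by omega⟩, 0)) ∨
            (y = (node 0 d 1 ⟨hd, le_rfl, by omega⟩, 0) ∨
            y = (node 0 (R.inv d) 1 ⟨hd.inv hd', le_rfl, by omega⟩, 0)) ∨
            (x.1 ∈ X ↔ y.1 ∈ X)) (fun x y h => by tauto) ?_ ?_ ?_ ?_ ?_ ?_ ?_ ?_
        · exact fun j => Or.inr (Or.inr (iff_of_false (m1 _ _) m0))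
        · exact fun j v _ => Or.inr (Or.inr (iff_of_false (m1 _ _) (m1 _ _)))
        · intro j e h
          by_cases hj : j = 0
          · subst hj
            by_cases h1 : e = d
            · subst h1
              exact Or.inl (Or.inl rfl)
            · by_cases h2 : e = R.inv d
              · subst h2
                exact Or.inl (Or.inr rfl)
              · exact Or.inr (Or.inr (iff_of_false (by rw [m2]; tauto) (m1 _ _)))
          · exact Or.inr (Or.inr (iff_of_false (by rw [m2]; tauto) (m1 _ _)))
        · exact fun j d n h h' _ => Or.inr (Or.inr ((m2 _ _ _ _).trans (m2 _ _ _ _).symm))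
        · exact fun j d n h h' _ => Or.inr (Or.inr ((m2 _ _ _ _).trans (m2 _ _ _ _).symm))
        · exact fun j d n h h' _ => Or.inr (Or.inr ((m2 _ _ _ _).trans (m2 _ _ _ _).symm))
        · intro j e n h h' _ he
          have h1 : e ≠ d := fun h => hd' (h ▸ he)
          have h2 : e ≠ R.inv d := fun h => ne (h ▸ he)
          exact Or.inr (Or.inr (by rw [m2, m2]; tauto))
        · intro j e n h h' _ _
          refine Or.inr (Or.inr ?_)
          rw [m2, m2, R.inv_injective.eq_iff, R.inv_eq_iff, or_comm (a := e = d)]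
    rw [stub_eq, stub_eq, ← neg_add, neg_eq_zero] at h0
    exact h0
  refine ⟨fun d => ?_, fun v => hf.conserve _, fun d => hf.mem _⟩
  by_cases h0 : d = (R.root, 0)
  · subst h0
    exact (neg_eq_of_add_eq_zero_right key_root).symm
  by_cases h1 : d = R.inv (R.root, 0)
  · subst h1
    rw [R.inv_inv]
    exact (neg_eq_of_add_eq_zero_left key_root).symm
  by_cases hs : R.IsStub d
  · exact (neg_eq_of_add_eq_zero_right (key_stub d hs h1)).symm
  · rw [← hf.antisymm, inv_rotation, rotInv_tree hs h0]

end RootedCubicMap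

namespace RootedCubicMap

variable {V : Type} {R : RootedCubicMap V} {B : ℕ}

/-! ### Bridges -/

/-- A set of vertices which contains none or both ends of the edge of the half-edge `x`. -/
def Uncut (X : Set (R.RotVertex B)) (x : R.RotVertex B × Fin 3) : Prop :=
  x.1 ∈ X ↔ (R.rotInv B x).1 ∈ X

/-- Climb uncut parent edges to the root without leaving `C`. -/
lemma mem_iff_none_mem {X C : Set (R.RotVertex B)} (hX : ∀ z ∈ C, z ≠ none → Uncut X (z, 0))
    (hC : ∀ z ∈ C, z ≠ none → (R.rotInv B (z, 0)).1 ∈ C) {z : R.RotVertex B} (hz : z ∈ C) :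
    z ∈ X ↔ none ∈ X := by
  induction hn : level z using Nat.strong_induction_on generalizing z with
  | _ n ih =>
    by_cases h0 : z = none
    · rw [h0]
    · have hl := (isTreeLink_up h0).2.2.2.2
      exact (hX z hz h0).trans (ih _ (by simp only at hl; omega) (hC z hz h0) rfl)

lemma leaf_mem_iff {X : Set (R.RotVertex B)} (hX : ∀ z, IsLeaf z → Uncut X (z, 1)) (j : Fin 3)
    (d : V × Fin 3) (n : ℕ) (h : R.IsStub d ∧ 1 ≤ n ∧ n < 2 * R.size B d)
    (h' : R.IsStub d ∧ 1 ≤ R.size B d ∧ R.size B d < 2 * R.size B d)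
    (hn : R.size B d ≤ n) : node j d n h ∈ X ↔ node j d (R.size B d) h' ∈ X := by
  induction n, hn using Nat.le_induction with
  | base => rfl
  | succ n hn ih =>
    rw [← ih ⟨h.1, by omega⟩]
    have := hX (node j d n ⟨h.1, by omega⟩) hn
    rw [Uncut, rotInv_next hn h] at this
    exact this.symm

lemma leaf_mem_iff_inv {X : Set (R.RotVertex B)} (hX : ∀ z, IsLeaf z → Uncut X (z, 1))
    (j : Fin 3) {d : V × Fin 3} (hd : d ≠ R.inv (R.root, 0))
    (h : R.IsStub d ∧ 1 ≤ R.size B d ∧ R.size B d < 2 * R.size B d)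
    (h' : R.IsStub (R.inv d) ∧ 1 ≤ R.size B (R.inv d) ∧
      R.size B (R.inv d) < 2 * R.size B (R.inv d)) :
    node j d (R.size B d) h ∈ X ↔ node j (R.inv d) (R.size B (R.inv d)) h' ∈ X := by
  have := hX (node j d (2 * R.size B d - 1) ⟨h.1, by omega⟩) (by simp; omega)
  rw [Uncut, rotInv_last (by omega) hd h'] at this
  rw [← this]
  exact (leaf_mem_iff hX _ _ _ _ h (by omega)).symm

lemma leaf_mem_iff_next {X : Set (R.RotVertex B)} (hX : ∀ z, IsLeaf z → Uncut X (z, 1))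
    (j : Fin 3) {d : V × Fin 3} (hd : d = R.inv (R.root, 0))
    (h : R.IsStub d ∧ 1 ≤ R.size B d ∧ R.size B d < 2 * R.size B d) :
    node j d (R.size B d) h ∈ X ↔ node (j + 1) d (R.size B d) h ∈ X := by
  have := hX (node j d (2 * R.size B d - 1) ⟨h.1, by omega⟩) (by simp; omega)
  rw [Uncut, rotInv_last_root (by omega) hd h] at this
  rw [← this]
  exact (leaf_mem_iff hX _ _ _ _ h (by omega)).symm

/-- Descend through the children `2 * n`, then walk along the leaves. Only parent edges of nodes
beyond `n` are used, so the one of `n` may be cut. -/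
lemma node_mem_iff_leaf {X : Set (R.RotVertex B)} (hX : ∀ z, IsLeaf z → Uncut X (z, 1))
    {j : Fin 3} {d : V × Fin 3} {n : ℕ} (hd : ∀ k h, n < k → Uncut X (node j d k h, 0))
    (h : R.IsStub d ∧ 1 ≤ n ∧ n < 2 * R.size B d)
    (h' : R.IsStub d ∧ 1 ≤ R.size B d ∧ R.size B d < 2 * R.size B d) :
    node j d n h ∈ X ↔ node j d (R.size B d) h' ∈ X := by
  induction hk : R.size B d - n using Nat.strong_induction_on generalizing n with
  | _ k ih =>
    by_cases hn : R.size B d ≤ n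
    · exact leaf_mem_iff hX j d n h h' hn
    · rw [← ih (R.size B d - 2 * n) (by omega) (n := 2 * n) (fun k h hk => hd k h (by omega))
        ⟨h.1, by omega⟩ rfl]
      have := hd (2 * n) ⟨h.1, by omega⟩ (by omega)
      rw [Uncut, rotInv_node_even rfl h] at this
      exact this.symm

lemma node_mem_iff_base {X : Set (R.RotVertex B)} {j : Fin 3} {d : V × Fin 3} {n : ℕ}
    (hd : ∀ k h, Uncut X (node j d k h, 0)) (h : R.IsStub d ∧ 1 ≤ n ∧ n < 2 * R.size B d) :
    node j d n h ∈ X ↔ base j d.1 ∈ X := by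
  induction n using Nat.strong_induction_on with
  | _ n ih =>
    have h1 := hd n h
    by_cases hn : n = 1
    · subst hn
      rwa [Uncut, rotInv_node_one] at h1
    · rcases Nat.even_or_odd' n with ⟨m, rfl | rfl⟩
      · rw [Uncut, rotInv_node_even rfl ⟨h.1, by omega⟩] at h1
        exact h1.trans (ih m (by omega) _)
      · rw [Uncut, rotInv_node_odd rfl ⟨h.1, by omega⟩] at h1
        exact h1.trans (ih m (by omega) _)

/-- Node numbers drop on passing to the parent. Since `m ≤ n` becomes `m < n`, this covers both the
step up from the node `n` and all steps up from vertices outside the nodes numbered at least `n`. -/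
lemma parent_cases {z : R.RotVertex B} (hz : z ≠ none) {j : Fin 3} {d : V × Fin 3} {n : ℕ}
    (hC : ∀ m h, z = node j d m h → m ≤ n) :
    ∀ m h, (R.rotInv B (z, 0)).1 = node j d m h → m < n := by
  revert hz hC
  refine rotVertex_cases (P := fun z => z ≠ none → (∀ m h, z = node j d m h → m ≤ n) →
    ∀ m h, (R.rotInv B (z, 0)).1 = node j d m h → m < n) (by simp) ?_ ?_ z
  · intro k v _ _ m h
    by_cases hv : v = R.root
    · subst hv
      rw [rotInv_root]
      simp
    · rw [rotInv_tree (d := (v, 0)) (fun h => h.1 rfl) (by simpa using hv)]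
      simp
  · intro k e l hl _ hC m h
    by_cases h1 : l = 1
    · subst h1
      rw [rotInv_node_one]
      simp
    · rcases Nat.even_or_odd' l with ⟨r, rfl | rfl⟩
      · rw [rotInv_node_even rfl ⟨hl.1, by omega⟩]
        intro he
        obtain ⟨rfl, rfl, rfl⟩ := node_inj.1 he
        have := hC (2 * r) hl rfl
        have := h.2.1
        omega
      · rw [rotInv_node_odd rfl ⟨hl.1, by omega⟩]
        intro he
        obtain ⟨rfl, rfl, rfl⟩ := node_inj.1 he
        have := hC (2 * r + 1) hl rfl
        omega

/-- A detour around the edge: down to a leaf, along the leaf cycle into another tree, and up to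
`none`, which the parent also reaches. -/
lemma uncut_node {X : Set (R.RotVertex B)} {j : Fin 3} {d : V × Fin 3} {n : ℕ}
    (h : R.IsStub d ∧ 1 ≤ n ∧ n < 2 * R.size B d)
    (hX : ∀ x, x ≠ (node j d n h, 0) → x ≠ R.rotInv B (node j d n h, 0) → Uncut X x) :
    Uncut X (node j d n h, 0) := by
  have up := isTreeLink_up (node_ne_none (j := j) (h := h))
  have up2 : ∀ z : R.RotVertex B, z ≠ none → (z, 0) ≠ R.rotInv B (node j d n h, 0) := by
    rintro z hz he
    rw [← he] at up
    exact up.2.2.2.1.elim hz (fun h => h rfl)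
  have hleaf : ∀ z, IsLeaf z → Uncut X (z, 1) := fun z hz =>
    hX _ (by simp) (fun he => up.2.2.1 (he ▸ hz))
  have hs := R.size_pos B d
  have h1 : node j d n h ∈ X ↔ node j d (R.size B d) ⟨h.1, by omega⟩ ∈ X := by
    refine node_mem_iff_leaf hleaf (fun k hk hnk => hX _ ?_ (up2 _ (by simp))) h _
    simp
    omega
  -- Excludes the nodes of this tree numbered at least `n`; hence closed under parents and free of
  -- the lower end of the edge.
  let C : Set (R.RotVertex B) := {z | ∀ m h, z = node j d m h → m < n}
  have hC : ∀ z ∈ C, z ∈ X ↔ none ∈ X := by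
    intro z hz
    refine mem_iff_none_mem (C := C) (fun z hz h0 => hX _ ?_ (up2 z h0)) ?_ hz
    · intro he
      exact lt_irrefl _ (hz n h (Prod.mk.inj he).1)
    · exact fun z hz h0 => parent_cases h0 fun m h he => (hz m h he).le
  have h2 : (R.rotInv B (node j d n h, 0)).1 ∈ C :=
    parent_cases (by simp) fun m h he => ((node_inj.1 he).2.2).ge
  rw [Uncut, hC _ h2, h1]
  by_cases hd : d = R.inv (R.root, 0)
  · rw [leaf_mem_iff_next hleaf j hd]
    refine hC _ fun m h he => ?_
    have hj : ∀ j : Fin 3, j + 1 ≠ j := by decide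
    exact absurd (node_inj.1 he).1 (hj j)
  · have hs' := R.size_pos B (R.inv d)
    rw [leaf_mem_iff_inv hleaf j hd _ ⟨h.1.inv hd, by omega⟩]
    exact hC _ fun m h he => absurd (node_inj.1 he).2.1 (R.inv_ne d)

/-- The trace of `X` on branch `j` is a vertex set of the bridgeless original graph. Uncut gadgets
stand for its edges off the tree; the root's extra edge is simulated by a route through the unpaired
tree, the next branch and `none`. -/
lemma uncut_base (hR : R.Bridgeless) {X : Set (R.RotVertex B)} {j : Fin 3} {v : V}
    (hX : ∀ x, x ≠ (base j v, 0) → x ≠ R.rotInv B (base j v, 0) → Uncut X x) :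
    Uncut X (base j v, 0) := by
  have up := isTreeLink_up (x := (base j v : R.RotVertex B)) (by simp)
  have up2 : ∀ z : R.RotVertex B, z ≠ none → (z, 0) ≠ R.rotInv B (base j v, 0) := by
    rintro z hz he
    rw [← he] at up
    exact up.2.2.2.1.elim hz (fun h => h rfl)
  have hleaf : ∀ z, IsLeaf z → Uncut X (z, 1) := fun z hz =>
    hX _ (by simp) (fun he => up.2.2.1 (he ▸ hz))
  have hnode : ∀ k d n h, Uncut X (node k d n h, 0) := fun k d n h =>
    hX _ (by simp) (up2 _ (by simp))
  have stub : ∀ k d h, base k d.1 ∈ X ↔ node k d (R.size B d) h ∈ X := fun k d h =>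
    (node_mem_iff_base (hnode k d) h).symm
  let d₀ := R.inv (R.root, 0)
  have hs : R.IsStub d₀ ∧ 1 ≤ R.size B d₀ ∧ R.size B d₀ < 2 * R.size B d₀ := by
    have := R.size_pos B d₀
    exact ⟨isStub_inv_root, by omega⟩
  -- The next branch does not contain the lower end `base j v`, so its parent edges are all uncut.
  have far : base (j + 1) d₀.1 ∈ X ↔ none ∈ X := by
    refine mem_iff_none_mem (C := {z | z = none ∨ ∃ v, z = base (j + 1) v}) ?_ ?_
      (Or.inr ⟨_, rfl⟩)
    · rintro z (rfl | ⟨w, rfl⟩) h0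
      · exact absurd rfl h0
      · refine hX _ ?_ (up2 _ h0)
        have hj : ∀ j : Fin 3, j + 1 ≠ j := by decide
        simp [hj]
    · rintro z (rfl | ⟨w, rfl⟩) h0
      · exact absurd rfl h0
      · by_cases hw : w = R.root
        · subst hw
          rw [rotInv_root]
          exact Or.inl rfl
        · rw [rotInv_tree (d := (w, 0)) (fun h => h.1 rfl) (by simpa using hw)]
          exact Or.inr ⟨_, rfl⟩
  have near : base j d₀.1 ∈ X ↔ none ∈ X := by
    rw [← far, stub j d₀ hs, stub (j + 1) d₀ hs, leaf_mem_iff_next hleaf j rfl]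
  have key : v ∈ {u : V | base j u ∈ X} ↔ (R.inv (v, 0)).1 ∈ {u : V | base j u ∈ X} := by
    have root_mem : v ≠ R.root → (base j R.root ∈ X ↔ none ∈ X) := by
      intro hv
      have := hX (base j R.root, 0) (by simpa using Ne.symm hv) (up2 _ (by simp))
      rwa [Uncut, rotInv_root] at this
    refine hR.mem_iff (d := (v, 0)) fun e h1 h2 => ?_
    change base j e.1 ∈ X ↔ base j (R.inv e).1 ∈ X
    by_cases h3 : e = (R.root, 0)
    · have hv : v ≠ R.root := fun h => h1 (by rw [h3, h])
      rw [h3, near]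
      exact root_mem hv
    by_cases h4 : e = d₀
    · have hv : v ≠ R.root := fun h => h2 (by rw [h4, h])
      rw [h4, near, R.inv_inv]
      exact (root_mem hv).symm
    by_cases h5 : R.IsStub e
    · have s1 := R.size_pos B e
      have s2 := R.size_pos B (R.inv e)
      rw [stub j e ⟨h5, by omega⟩, stub j (R.inv e) ⟨h5.inv h4, by omega⟩]
      exact leaf_mem_iff_inv hleaf j h4 _ _
    · have := hX (base j e.1, e.2) (fun he => h1 ?_) (fun he => ?_)
      · rwa [Uncut, rotInv_tree h5 h3] at this
      · simp only [Prod.mk.injEq, Option.some.injEq, Sum.inl.injEq, true_and] at he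
        exact Prod.ext he.1 he.2
      · have h6 := congrArg (R.rotInv B) he
        rw [show R.rotInv B (R.rotInv B (base j v, 0)) = (base j v, 0) from
            (R.rotation B).inv_inv (base j v, 0),
          rotInv_tree h5 h3] at h6
        simp only [Prod.mk.injEq, Option.some.injEq, Sum.inl.injEq, true_and] at h6
        exact h2 (R.inv_eq_iff.1 (Prod.ext h6.1 h6.2))
  change base j v ∈ X ↔ base j (R.inv (v, 0)).1 ∈ X at key
  by_cases hv : v = R.root
  · subst hv
    rw [Uncut, rotInv_root]
    exact key.trans near
  · rwa [Uncut, rotInv_tree (d := (v, 0)) (fun h => h.1 rfl) (by simpa using hv)]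

/-- Parent edges are handled by `uncut_node` and `uncut_base`. Without an edge of a leaf cycle, the
spanning tree still joins all vertices. -/
lemma bridgeless_rotation (hR : R.Bridgeless) : (R.rotation B).Bridgeless := by
  intro x X hx hX
  suffices h : (∀ y, y ≠ x → y ≠ R.rotInv B x → Uncut X y) → Uncut X x by
    refine (h fun y h1 h2 => ⟨hX y h1 h2, fun h3 => ?_⟩).1 hx
    have := hX (R.rotInv B y) (fun h => h2 ((R.rotation B).inv_eq_iff.1 h))
      (fun h => h1 ((R.rotation B).inv_injective h)) h3
    rwa [← inv_rotation, CubicMap.inv_inv] at this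
  clear hX hx
  have down : ∀ x : R.RotVertex B × Fin 3, IsTreeLink x (R.rotInv B x) →
      (∀ y, y ≠ x → y ≠ R.rotInv B x → Uncut X y) → Uncut X x := by
    rintro ⟨z, i⟩ ⟨hz, rfl : i = 0, -⟩
    revert hz
    refine rotVertex_cases (P := fun z => z ≠ none →
      (∀ y, y ≠ (z, 0) → y ≠ R.rotInv B (z, 0) → Uncut X y) → Uncut X (z, 0)) ?_ ?_ ?_ z
    · exact fun h => absurd rfl h
    · exact fun j v _ h => uncut_base hR h
    · exact fun j d n h _ h' => uncut_node h h'
  intro hX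
  rcases link_cases x with h | h | h
  · exact down x h hX
  · have hi : R.rotInv B (R.rotInv B x) = x := (R.rotation B).inv_inv x
    have := down (R.rotInv B x) (by rwa [hi]) fun y h1 h2 => hX y (by rwa [hi] at h2) h1
    rw [Uncut, hi] at this
    exact this.symm
  · have h0 : ∀ z : R.RotVertex B, z ∈ X ↔ none ∈ X := by
      intro z
      refine mem_iff_none_mem (C := Set.univ) (fun z _ hz => hX _ ?_ ?_) (fun _ _ _ => trivial)
        trivial
      · rintro rfl
        have := h.2.2
        simp at this
      · intro he
        have := h.2.2
        rw [← he] at this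
        simp at this
    exact (h0 _).trans (h0 _).symm

end RootedCubicMap
/-! ### Trees given by parents -/

section ParentTree

variable {V : Type} {root : V} {p : V → V} {l : V → ℕ}

/-- The graph in which each vertex other than `root` is adjacent to its parent. -/
def parentGraph (root : V) (p : V → V) : SimpleGraph V :=
  SimpleGraph.fromRel fun v w => v ≠ root ∧ p v = w

lemma parentGraph_adj_parent (hl : ∀ v, v ≠ root → l (p v) + 1 = l v) {v : V} (hv : v ≠ root) :
    (parentGraph root p).Adj v (p v) := by
  refine ⟨fun h => ?_, Or.inl ⟨hv, rfl⟩⟩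
  have := hl v hv
  rw [← h] at this
  omega

lemma exists_walk_parentGraph (hl : ∀ v, v ≠ root → l (p v) + 1 = l v) (v : V) :
    ∃ w : (parentGraph root p).Walk v root, w.length ≤ l v := by
  induction hn : l v using Nat.strong_induction_on generalizing v with
  | _ n ih =>
    by_cases hv : v = root
    · subst hv
      exact ⟨SimpleGraph.Walk.nil, by simp⟩
    · have h1 := hl v hv
      obtain ⟨w, hw⟩ := ih (l (p v)) (by omega) (p v) rfl
      refine ⟨SimpleGraph.Walk.cons (parentGraph_adj_parent hl hv) w, ?_⟩
      rw [SimpleGraph.Walk.length_cons]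
      omega

/-- Levels change by exactly one along each edge. -/
lemma level_le_length (hl : ∀ v, v ≠ root → l (p v) + 1 = l v) {v w : V}
    (q : (parentGraph root p).Walk v w) : l v ≤ l w + q.length := by
  induction q with
  | nil => simp
  | cons h q ih =>
    rw [SimpleGraph.Walk.length_cons]
    rcases h.2 with ⟨h1, rfl⟩ | ⟨h1, rfl⟩
    · have := hl _ h1
      omega
    · have := hl _ h1
      omega

lemma parentGraph_connected (hl : ∀ v, v ≠ root → l (p v) + 1 = l v) :
    (parentGraph root p).Connected := by
  rw [SimpleGraph.connected_iff_exists_forall_reachable]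
  exact ⟨root, fun v => (exists_walk_parentGraph hl v).choose.reachable.symm⟩

lemma parentGraph_dist (hl : ∀ v, v ≠ root → l (p v) + 1 = l v) (h0 : l root = 0) (v : V) :
    (parentGraph root p).dist root v = l v := by
  rw [SimpleGraph.dist_comm]
  obtain ⟨w, hw⟩ := exists_walk_parentGraph hl v
  obtain ⟨q, hq⟩ := w.reachable.exists_walk_length_eq_dist
  have h1 := level_le_length hl q
  have h2 := (parentGraph root p).dist_le w
  omega

/-- Connected, and with at most one edge `s(v, p v)` for each `v ≠ root`. -/
lemma parentGraph_isTree [Finite V] (hl : ∀ v, v ≠ root → l (p v) + 1 = l v) :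
    (parentGraph root p).IsTree := by
  have hc := parentGraph_connected hl
  refine SimpleGraph.isTree_iff_connected_and_card.2 ⟨hc, le_antisymm ?_ ?_⟩
  · have h1 : (parentGraph root p).edgeSet ⊆ (fun v => s(v, p v)) '' {root}ᶜ := by
      intro e
      induction e with
      | _ v w =>
        rintro ⟨-, ⟨h, h'⟩ | ⟨h, h'⟩⟩
        · exact ⟨v, h, congrArg (fun z => s(v, z)) h'⟩
        · exact ⟨w, h, (congrArg (fun z => s(w, z)) h').trans Sym2.eq_swap⟩
    have h2 := (Set.ncard_le_ncard h1 (Set.toFinite _)).trans (Set.ncard_image_le (Set.toFinite _))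
    have h3 := Set.ncard_add_ncard_compl ({root} : Set V)
    rw [Set.ncard_singleton] at h3
    rw [Nat.card_coe_set_eq]
    omega
  · exact hc.card_vert_le_card_edgeSet_add_one

end ParentTree

lemma dist_eq_of_iso {V V' : Type} {T : SimpleGraph V} {T' : SimpleGraph V'} (φ : T' ≃g T)
    (hT : T.Connected) (x y : V') : T'.dist x y = T.dist (φ x) (φ y) := by
  have le : ∀ {V V' : Type} {T : SimpleGraph V} {T' : SimpleGraph V'} (φ : T' ≃g T) (x y : V'),
      T'.Reachable x y → T.dist (φ x) (φ y) ≤ T'.dist x y := by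
    intro V V' T T' φ x y h
    obtain ⟨q, hq⟩ := h.exists_walk_length_eq_dist
    have := T.dist_le (q.map φ.toHom)
    rwa [SimpleGraph.Walk.length_map, hq] at this
  refine le_antisymm ?_ (le φ x y (φ.connected_iff.2 hT x y))
  simpa using le φ.symm (φ x) (φ y) (hT _ _)

lemma ncard_neighborSet_of_iso {V V' : Type} {T : SimpleGraph V} {T' : SimpleGraph V'}
    (φ : T' ≃g T) (x : V') : (T'.neighborSet x).ncard = (T.neighborSet (φ x)).ncard := by
  rw [← Nat.card_coe_set_eq, ← Nat.card_coe_set_eq]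
  exact Nat.card_congr (φ.mapNeighborSet x)

lemma IsRootedTree.of_iso {V V' : Type} {T : SimpleGraph V} {T' : SimpleGraph V'} (φ : T' ≃g T)
    {r i : ℕ} {root : V'} (h : IsRootedTree T r i (φ root)) : IsRootedTree T' r i root where
  isTree := φ.isTree_iff.2 h.isTree
  degrees x := by
    rw [ncard_neighborSet_of_iso φ]
    exact h.degrees _
  dist_leaf x hx := by
    rw [dist_eq_of_iso φ h.isTree.connected]
    rw [ncard_neighborSet_of_iso φ] at hx
    exact h.dist_leaf _ hx

/-! ### The spanning tree and its rotation -/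

namespace RootedCubicMap

variable {V : Type} {R : RootedCubicMap V} {B : ℕ}

variable (R B) in
/-- The spanning tree of the rotation graph. -/
noncomputable def rotTree : SimpleGraph (R.RotVertex B) :=
  parentGraph none fun x => (R.rotInv B (x, 0)).1

lemma level_parent (x : R.RotVertex B) (hx : x ≠ none) :
    level (R.rotInv B (x, 0)).1 + 1 = level x :=
  (isTreeLink_up hx).2.2.2.2

lemma rotTree_adj_iff {x y : R.RotVertex B} : (R.rotTree B).Adj x y ↔
    (x ≠ none ∧ (R.rotInv B (x, 0)).1 = y) ∨ (y ≠ none ∧ (R.rotInv B (y, 0)).1 = x) := by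
  refine ⟨fun h => h.2, fun h => ⟨?_, h⟩⟩
  rintro rfl
  have h' := or_self_iff.1 h
  have := level_parent x h'.1
  rw [h'.2] at this
  omega

lemma exists_inv_eq_of_rotTree_adj {x y : R.RotVertex B} (h : (R.rotTree B).Adj x y) :
    ∃ i, (R.rotInv B (x, i)).1 = y := by
  rcases rotTree_adj_iff.1 h with ⟨-, h⟩ | ⟨-, h⟩
  · exact ⟨0, h⟩
  · refine ⟨(R.rotInv B (y, 0)).2, ?_⟩
    rw [← h]
    exact congrArg Prod.fst ((R.rotation B).inv_inv (y, 0))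

/-- All three edges at an inner vertex belong to the tree, and by `rotation_simple` they have
distinct ends. -/
lemma ncard_neighborSet_of_not_isLeaf (hB : ∀ v, R.depth v ≤ B) {x : R.RotVertex B}
    (hx : ¬ IsLeaf x) : ((R.rotTree B).neighborSet x).ncard = 3 := by
  have h : (R.rotTree B).neighborSet x = Set.range fun i => (R.rotInv B (x, i)).1 := by
    refine Set.Subset.antisymm (fun y hy => exists_inv_eq_of_rotTree_adj hy) ?_
    rintro _ ⟨i, rfl⟩
    refine rotTree_adj_iff.2 ?_
    rcases link_cases (x, i) with h | h | h
    · obtain rfl : i = 0 := h.2.1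
      exact Or.inl ⟨h.1, rfl⟩
    · refine Or.inr ⟨h.1, ?_⟩
      have h2 : R.rotInv B (x, i) = ((R.rotInv B (x, i)).1, 0) := Prod.ext rfl h.2.1
      rw [← h2]
      exact congrArg Prod.fst ((R.rotation B).inv_inv (x, i))
    · exact absurd h.1 hx
  rw [h, ← Set.image_univ]
  exact (Set.ncard_image_of_injective Set.univ (rotation_simple hB x)).trans (by simp)

lemma ncard_neighborSet_of_isLeaf {x : R.RotVertex B} (hx : IsLeaf x) :
    ((R.rotTree B).neighborSet x).ncard = 1 := by
  refine Set.ncard_eq_one.2 ⟨(R.rotInv B (x, 0)).1, Set.eq_singleton_iff_unique_mem.2 ⟨?_, ?_⟩⟩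
  · refine rotTree_adj_iff.2 (Or.inl ⟨?_, rfl⟩)
    rintro rfl
    exact hx
  · intro y hy
    rcases rotTree_adj_iff.1 hy with ⟨-, h⟩ | ⟨h0, h⟩
    · exact h.symm
    · exact absurd (h ▸ hx) (isTreeLink_up h0).2.2.1

lemma isRootedTree_rotTree [Finite V] (hB : ∀ v, R.depth v ≤ B) :
    IsRootedTree (R.rotTree B) 3 (B + 3) none where
  isTree := parentGraph_isTree level_parent
  degrees x := by
    by_cases hx : IsLeaf x
    · exact Or.inl (ncard_neighborSet_of_isLeaf hx)
    · exact Or.inr (ncard_neighborSet_of_not_isLeaf hB hx)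
  dist_leaf x hx := by
    have hx : IsLeaf x := by
      by_contra h
      rw [ncard_neighborSet_of_not_isLeaf hB h] at hx
      omega
    rw [← level_of_isLeaf hB x hx]
    exact parentGraph_dist level_parent rfl x

variable (R B) in
/-- The rotation, which permutes the branches cyclically. -/
def rotate : Equiv.Perm (R.RotVertex B) :=
  Equiv.optionCongr (Equiv.prodCongr (Equiv.addRight 1) (Equiv.refl _))

@[simp] lemma rotate_none : R.rotate B none = none := rfl

@[simp] lemma rotate_base (j : Fin 3) (v : V) :
    R.rotate B (base j v) = base (j + 1) v := rfl

@[simp] lemma rotate_node (j : Fin 3) (d : V × Fin 3) (n : ℕ)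
    (h : R.IsStub d ∧ 1 ≤ n ∧ n < 2 * R.size B d) :
    R.rotate B (node j d n h) = node (j + 1) d n h := rfl

open scoped Classical in
/-- The action of the rotation on half-edges. -/
noncomputable def rotateHalf (x : R.RotVertex B × Fin 3) : R.RotVertex B × Fin 3 :=
  -- At `none` the index names the branch, so it moves along.
  (R.rotate B x.1, if x.1 = none then x.2 + 1 else x.2)

lemma rotInv_rotateHalf : ∀ x : R.RotVertex B × Fin 3,
    R.rotInv B (rotateHalf x) = rotateHalf (R.rotInv B x) := by
  refine rotInv_cases (P := fun x y => R.rotInv B (rotateHalf x) = rotateHalf y)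
    ?_ ?_ ?_ ?_ ?_ ?_ ?_ ?_ ?_
  · intro x y h
    rw [← h]
    exact (R.rotation B).inv_inv _
  · intro j
    simp [rotateHalf, rotInv_root]
  · intro j v hv
    have := rotInv_tree (B := B) (j := j + 1) (d := (v, 0)) (fun h => h.1 rfl) (by simpa using hv)
    simpa [rotateHalf] using this
  · intro j d h
    simp [rotateHalf, rotInv_node_one]
  · intro j d n h h' hn
    simp [rotateHalf, rotInv_node_even rfl h']
  · intro j d n h h' hn
    simp [rotateHalf, rotInv_node_odd rfl h']
  · intro j d n h h' hn
    simp [rotateHalf, rotInv_next hn h']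
  · intro j d n h h' hn hd
    simp [rotateHalf, rotInv_last_root hn hd h']
  · intro j d n h h' hn hd
    simp [rotateHalf, rotInv_last hn hd h']

lemma rotate_inv_zero {x : R.RotVertex B} (hx : x ≠ none) :
    (R.rotInv B (R.rotate B x, 0)).1 = R.rotate B (R.rotInv B (x, 0)).1 := by
  have := congrArg Prod.fst (rotInv_rotateHalf (x, 0))
  simpa [rotateHalf, hx] using this

lemma rotate_eq_none {x : R.RotVertex B} : R.rotate B x = none ↔ x = none :=
  (R.rotate B).injective.eq_iff' rfl

lemma rotTree_rotate_adj (x y : R.RotVertex B) :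
    (R.rotTree B).Adj (R.rotate B x) (R.rotate B y) ↔ (R.rotTree B).Adj x y := by
  have key : ∀ x y : R.RotVertex B, (R.rotate B x ≠ none ∧
      (R.rotInv B (R.rotate B x, 0)).1 = R.rotate B y) ↔
      (x ≠ none ∧ (R.rotInv B (x, 0)).1 = y) := by
    intro x y
    rw [ne_eq, rotate_eq_none]
    refine and_congr_right fun hx => ?_
    rw [rotate_inv_zero hx, (R.rotate B).injective.eq_iff]
  rw [rotTree_adj_iff, rotTree_adj_iff, key, key]

lemma exists_inv_rotate_iff (x y : R.RotVertex B) :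
    (∃ i, (R.rotInv B (R.rotate B x, i)).1 = R.rotate B y) ↔
      ∃ i, (R.rotInv B (x, i)).1 = y := by
  have h : ∀ i, (R.rotInv B (rotateHalf (x, i))).1 = R.rotate B y ↔
      (R.rotInv B (x, i)).1 = y := fun i => by
    rw [rotInv_rotateHalf]
    exact (R.rotate B).injective.eq_iff
  by_cases hx : x = none
  · constructor
    · rintro ⟨i, hi⟩
      refine ⟨i - 1, (h _).1 ?_⟩
      simpa [rotateHalf, hx] using hi
    · rintro ⟨i, hi⟩
      refine ⟨i + 1, ?_⟩
      simpa [rotateHalf, hx] using (h _).2 hi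
  · refine exists_congr fun i => ?_
    rw [← h i]
    simp [rotateHalf, hx]

lemma minimalPeriod_rotate {x : R.RotVertex B} (hx : x ≠ none) :
    Function.minimalPeriod (R.rotate B) x = 3 := by
  have : Fact (Nat.Prime 3) := ⟨Nat.prime_three⟩
  obtain ⟨⟨j, w⟩, rfl⟩ := Option.ne_none_iff_exists'.1 hx
  refine Function.minimalPeriod_eq_prime ?_ ?_
  · have h : ∀ j : Fin 3, j + 1 + 1 + 1 = j := by decide
    change some (j + 1 + 1 + 1, w) = some (j, w)
    rw [h]
  · intro h
    have h1 : ∀ j : Fin 3, j + 1 ≠ j := by decide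
    exact h1 j (Prod.mk.inj (Option.some.inj h)).1

lemma isRotational_rotate (hB : ∀ v, R.depth v ≤ B) :
    IsRotational (R.rotTree B) none (R.rotate B) where
  adj_iff := rotTree_rotate_adj
  period_self := Function.minimalPeriod_eq_one_iff_isFixedPt.2 rfl
  period_of_ne x hx := by
    rw [minimalPeriod_rotate hx, ncard_neighborSet_of_not_isLeaf hB not_isLeaf_none]

end RootedCubicMap
-- Translation between half-edges and `Graph`
/-- `M` presents the multigraph `G`. -/
structure Presentation {V α β : Type} (M : CubicMap V) (G : Graph α β) where
  vert : V ≃ V(G)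
  edge : V × Fin 3 → E(G)
  isLink : ∀ d, G.IsLink (edge d) (vert d.1) (vert (M.inv d).1)
  edge_eq_iff : ∀ d e, edge d = edge e ↔ d = e ∨ d = M.inv e
  edge_surjective : Function.Surjective edge

namespace Presentation

variable {V α β : Type} {M : CubicMap V} {G : Graph α β} (P : Presentation M G)
include P

lemma edge_inv (d : V × Fin 3) : P.edge (M.inv d) = P.edge d :=
  (P.edge_eq_iff _ _).2 (Or.inr rfl)

lemma vert_inj {v w : V} : (P.vert v : α) = P.vert w ↔ v = w := by
  rw [Subtype.coe_inj, P.vert.apply_eq_iff_eq]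

lemma edge_injective (v : V) : Function.Injective fun i => P.edge (v, i) := by
  intro i k h
  rcases (P.edge_eq_iff _ _).1 h with h | h
  · exact (Prod.mk.inj h).2
  · exact absurd (congrArg Prod.fst h).symm (M.fst_inv_ne (v, k))

lemma exists_of_isLink {e : E(G)} {x y : α} (h : G.IsLink e x y) :
    ∃ d, P.edge d = e ∧ x = P.vert d.1 ∧ y = P.vert (M.inv d).1 := by
  obtain ⟨d, rfl⟩ := P.edge_surjective e
  rcases h.eq_and_eq_or_eq_and_eq (P.isLink d) with ⟨h1, h2⟩ | ⟨h1, h2⟩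
  · exact ⟨d, rfl, h1, h2⟩
  · exact ⟨M.inv d, P.edge_inv d, h1, by rwa [M.inv_inv]⟩

lemma exists_of_inc {e : E(G)} {v : V} (h : G.Inc e (P.vert v)) : ∃ i, P.edge (v, i) = e := by
  obtain ⟨y, hy⟩ := h
  obtain ⟨d, h1, h2, -⟩ := P.exists_of_isLink hy
  rw [P.vert_inj] at h2
  exact ⟨d.2, by rw [h2, ← h1]⟩

lemma isFiniteLoopless [Finite V] : IsFiniteLoopless G where
  finite_vertexSet := Set.finite_coe_iff.1 (Finite.of_equiv V P.vert)
  finite_edgeSet := Set.finite_coe_iff.1 (Finite.of_surjective P.edge P.edge_surjective)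
  loopless := ⟨fun e x h => by
    obtain ⟨d, -, h1, h2⟩ := P.exists_of_isLink (e := ⟨e, h.edge_mem⟩) h
    exact M.fst_inv_ne d (P.vert_inj.1 (h2.symm.trans h1))⟩

lemma isRegular : IsRegular G 3 := by
  intro x hx
  obtain ⟨v, hv⟩ := P.vert.surjective ⟨x, hx⟩
  have h : G.incidenceSet x = Set.range fun i => (P.edge (v, i) : β) := by
    ext e
    have hxv : x = P.vert v := by rw [hv]
    constructor
    · intro he
      rw [Graph.mem_incidenceSet, hxv] at he
      obtain ⟨i, hi⟩ := P.exists_of_inc (e := ⟨e, he.edge_mem⟩) he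
      exact ⟨i, by simp only [hi]⟩
    · rintro ⟨i, rfl⟩
      rw [Graph.mem_incidenceSet, hxv]
      exact (P.isLink (v, i)).inc_left
  rw [degree, h, ← Set.image_univ]
  exact (Set.ncard_image_of_injective Set.univ
    (Subtype.val_injective.comp (P.edge_injective v))).trans (by simp)

open scoped Classical in
lemma finsum_eq_sum {A : Type} [AddCommGroup A] (g : E(G) → α) (f : E(G) → A)
    (hg : ∀ e : E(G), G.Inc e (g e)) (v : V) :
    ∑ᶠ e ∈ {e : E(G) | g e = P.vert v}, f e =
      ∑ i, if g (P.edge (v, i)) = P.vert v then f (P.edge (v, i)) else 0 := by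
  have h : {e : E(G) | g e = P.vert v} =
      (fun i => P.edge (v, i)) '' {i | g (P.edge (v, i)) = P.vert v} := by
    ext e
    constructor
    · intro he
      have := hg e
      rw [show g e = P.vert v from he] at this
      obtain ⟨i, rfl⟩ := P.exists_of_inc this
      exact ⟨i, he, rfl⟩
    · rintro ⟨i, hi, rfl⟩
      exact hi
  rw [h, finsum_mem_image (P.edge_injective v).injOn, ← Finset.sum_filter]
  have h2 : {i | g (P.edge (v, i)) = P.vert v} =
      ((Finset.univ.filter fun i => g (P.edge (v, i)) = P.vert v : Finset (Fin 3)) : Set (Fin 3)) := by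
    ext i
    simp
  rw [h2, finsum_mem_coe_finset]

/-- The value on a half-edge is `f` of its edge, negated when the edge enters there. Conversely, a
chosen half `δ e` of each edge gives the tail. -/
lemma hasNowhereZeroFlow_iff (k : ℕ) : HasNowhereZeroFlow G k ↔
    ∃ f : V × Fin 3 → ℤ, M.IsFlow {z | z ≠ 0 ∧ |z| < (k : ℤ)} f := by
  classical
  constructor
  · rintro ⟨tail, head, f, hl, hf, hc⟩
    have ends : ∀ d, (tail (P.edge d) = P.vert d.1 ∧ head (P.edge d) = P.vert (M.inv d).1) ∨
        (tail (P.edge d) = P.vert (M.inv d).1 ∧ head (P.edge d) = P.vert d.1) :=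
      fun d => (hl (P.edge d)).eq_and_eq_or_eq_and_eq (P.isLink d)
    have ne : ∀ d, (P.vert d.1 : α) ≠ P.vert (M.inv d).1 :=
      fun d h => M.fst_inv_ne d (P.vert_inj.1 h).symm
    refine ⟨fun d => if tail (P.edge d) = P.vert d.1 then f (P.edge d) else -f (P.edge d),
      fun d => ?_, fun v => ?_, fun d => ?_⟩
    · simp only [P.edge_inv]
      rcases ends d with ⟨h1, -⟩ | ⟨h1, -⟩
      · rw [h1, if_neg (ne d), if_pos rfl]
      · rw [h1, if_pos rfl, if_neg (ne d).symm, neg_neg]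
    · have := hc (P.vert v) (P.vert v).2
      rw [P.finsum_eq_sum head f (fun e => (hl e).inc_right) v,
        P.finsum_eq_sum tail f (fun e => (hl e).inc_left) v, eq_comm, ← sub_eq_zero,
        ← Finset.sum_sub_distrib] at this
      rw [← this]
      refine Finset.sum_congr rfl fun i _ => ?_
      have hne := ne (v, i)
      rcases ends (v, i) with ⟨h1, h2⟩ | ⟨h1, h2⟩
      · rw [h1, h2, if_pos rfl, if_pos rfl, if_neg hne.symm, sub_zero]
      · rw [h1, h2, if_neg hne.symm, if_pos rfl, if_neg hne.symm, zero_sub]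
    · have := hf (P.edge d)
      simp only [Set.mem_ofPred_eq]
      split_ifs
      · exact this
      · rwa [neg_ne_zero, abs_neg]
  · rintro ⟨f, hf⟩
    choose δ hδ using P.edge_surjective
    refine ⟨fun e => P.vert (δ e).1, fun e => P.vert (M.inv (δ e)).1, fun e => f (δ e),
      fun e => ?_, fun e => hf.mem _, fun x hx => ?_⟩
    · have := P.isLink (δ e)
      rwa [hδ] at this
    · obtain ⟨v, hv⟩ := P.vert.surjective ⟨x, hx⟩
      obtain rfl : (P.vert v : α) = x := by rw [hv]
      have hl : ∀ e : E(G), G.IsLink e (P.vert (δ e).1) (P.vert (M.inv (δ e)).1) := fun e => by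
        have := P.isLink (δ e)
        rwa [hδ] at this
      rw [P.finsum_eq_sum (fun e => P.vert (M.inv (δ e)).1) _ (fun e => (hl e).inc_right) v,
        P.finsum_eq_sum (fun e => P.vert (δ e).1) _ (fun e => (hl e).inc_left) v, eq_comm,
        ← sub_eq_zero, ← Finset.sum_sub_distrib]
      refine Eq.trans ?_ (hf.conserve v)
      refine Finset.sum_congr rfl fun i _ => ?_
      simp only [P.vert_inj]
      have hne := M.fst_inv_ne (v, i)
      rcases (P.edge_eq_iff _ _).1 (hδ (P.edge (v, i))) with h | h
      · rw [h, if_pos rfl, if_neg hne, sub_zero]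
      · rw [h, M.inv_inv, if_neg hne, if_pos rfl, hf.antisymm, zero_sub, neg_neg]

/-- The colours are the nonzero elements of the Klein four-group: all three sum to zero, and three
nonzero elements with sum zero are distinct. -/
lemma edgeColorable_iff : EdgeColorable G 3 ↔
    ∃ f : V × Fin 3 → ZMod 2 × ZMod 2, M.IsFlow {0}ᶜ f := by
  have hneg : ∀ a : ZMod 2 × ZMod 2, a = -a := by decide
  constructor
  · rintro ⟨c, hc⟩
    let φ : Fin 3 → ZMod 2 × ZMod 2 := ![(0, 1), (1, 0), (1, 1)]
    refine ⟨fun d => φ (c (P.edge d)), fun d => ?_, fun v => ?_, fun d => ?_⟩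
    · rw [P.edge_inv]
      exact hneg _
    · have hinj : Function.Injective fun i => c (P.edge (v, i)) := by
        intro i k h
        by_contra hik
        exact hc _ _ _ (fun h => hik (P.edge_injective v h)) (P.isLink (v, i)).inc_left
          (P.isLink (v, k)).inc_left h
      have := (Equiv.ofBijective _ (Finite.injective_iff_bijective.1 hinj)).sum_comp φ
      exact this.trans (by decide)
    · have : ∀ i, φ i ≠ 0 := by decide
      exact this _
  · rintro ⟨f, hf⟩
    choose δ hδ using P.edge_surjective
    let ψ : ZMod 2 × ZMod 2 → Fin 3 := fun a => if a = (0, 1) then 0 else if a = (1, 0) then 1 else 2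
    have hψ : ∀ a b, a ≠ 0 → b ≠ 0 → ψ a = ψ b → a = b := by decide
    have hsum : ∀ a b c : ZMod 2 × ZMod 2, c ≠ 0 → a + b + c = 0 → a ≠ b := by decide
    have hδf : ∀ d, f (δ (P.edge d)) = f d := fun d => by
      rcases (P.edge_eq_iff _ _).1 (hδ (P.edge d)) with h | h
      · rw [h]
      · rw [h, hf.antisymm, ← hneg]
    refine ⟨fun e => ψ (f (δ e)), fun e e' x hne he he' => ?_⟩
    obtain ⟨v, hv⟩ := P.vert.surjective ⟨x, he.vertex_mem⟩
    obtain rfl : (P.vert v : α) = x := by rw [hv]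
    obtain ⟨i, rfl⟩ := P.exists_of_inc he
    obtain ⟨k, rfl⟩ := P.exists_of_inc he'
    have hik : i ≠ k := fun h => hne (by rw [h])
    simp only [hδf]
    refine fun h => ?_
    have h := hψ _ _ (hf.mem _) (hf.mem _) h
    have hs := hf.conserve v
    rw [Fin.sum_univ_three] at hs
    have h0 := hf.mem (v, 0)
    have h1 := hf.mem (v, 1)
    have h2 := hf.mem (v, 2)
    have h01 := hsum _ _ _ h2 hs
    have h12 := hsum _ _ _ h0 (by rw [← hs]; abel : f (v, 1) + f (v, 2) + f (v, 0) = 0)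
    have h02 := hsum _ _ _ h1 (by rw [← hs]; abel : f (v, 0) + f (v, 2) + f (v, 1) = 0)
    fin_cases i <;> fin_cases k <;>
      first | exact hik rfl | exact h01 h | exact h12 h | exact h02 h | exact h01 h.symm |
        exact h12 h.symm | exact h02 h.symm

/-- A set that only `d` leaves confines every path from `d.1` avoiding its edge; conversely, the
vertices on such paths form a set that no other edge leaves. -/
lemma bridgeless_iff : (∀ e, ¬ IsBridge G e) ↔ M.Bridgeless := by
  constructor
  · intro h d X hd hX
    by_contra hd'
    refine h (P.edge d) ⟨_, _, P.isLink d, fun hr => hd' ?_⟩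
    suffices key : ∀ y, Relation.ReflTransGen (G.deleteEdges {(P.edge d : β)}).Adj (P.vert d.1) y →
        ∃ w ∈ X, y = P.vert w by
      obtain ⟨w, hw, h⟩ := key _ hr
      rwa [P.vert_inj.1 h]
    intro y hy
    induction hy with
    | refl => exact ⟨_, hd, rfl⟩
    | tail _ hyz ih =>
      obtain ⟨w, hw, rfl⟩ := ih
      obtain ⟨e, he⟩ := hyz
      rw [Graph.deleteEdges_isLink] at he
      obtain ⟨x, h1, h2, h3⟩ := P.exists_of_isLink (e := ⟨e, he.1.edge_mem⟩) he.1
      have hne : P.edge x ≠ P.edge d := fun h => he.2 (by rw [← h, h1]; rfl)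
      rw [P.vert_inj] at h2
      subst h2
      exact ⟨_, hX x (fun h => hne (by rw [h])) (fun h => hne (by rw [h, P.edge_inv])) hw, h3⟩
  · rintro hM e ⟨x, y, hl, hr⟩
    obtain ⟨d, h1, rfl, rfl⟩ := P.exists_of_isLink (e := ⟨e, hl.edge_mem⟩) hl
    refine hr (hM d {v | Relation.ReflTransGen (G.deleteEdges {e}).Adj (P.vert d.1) (P.vert v)}
      Relation.ReflTransGen.refl fun z hz1 hz2 hz => hz.tail ⟨P.edge z, ?_⟩)
    rw [Graph.deleteEdges_isLink]
    refine ⟨P.isLink z, fun h => ?_⟩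
    have : P.edge z = P.edge d := h1 ▸ Subtype.ext h
    rcases (P.edge_eq_iff _ _).1 this with h | h
    · exact hz1 h
    · exact hz2 h

/-- The boundary has the parity of `3 * |S|`, hence is odd, and a boundary of size one would be a
bridge. -/
lemma isRGraph [Finite V] (hM : M.Bridgeless) : IsRGraph G 3 where
  finite_loopless := P.isFiniteLoopless
  regular := P.isRegular
  le_boundary S hS hodd := by
    classical
    have := Fintype.ofFinite V
    let X : Set V := {v | (P.vert v : α) ∈ S}
    let D : Finset (V × Fin 3) := Finset.univ.filter fun d => d.1 ∈ X ∧ (M.inv d).1 ∉ X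
    have hD : ∀ d, d ∈ D ↔ d.1 ∈ X ∧ (M.inv d).1 ∉ X := fun d => by simp [D]
    have hb : boundary G S = (fun d => (P.edge d : β)) '' D := by
      ext e
      constructor
      · rintro ⟨x, hx, y, hy, hl⟩
        obtain ⟨d, h1, rfl, rfl⟩ := P.exists_of_isLink (e := ⟨e, hl.edge_mem⟩) hl
        exact ⟨d, (hD d).2 ⟨hx, hy⟩, by simp only [h1]⟩
      · rintro ⟨d, hd, rfl⟩
        exact ⟨_, ((hD d).1 hd).1, _, ((hD d).1 hd).2, P.isLink d⟩
    have hcard : (boundary G S).ncard = D.card := by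
      rw [hb, Set.InjOn.ncard_image, Set.ncard_coe_finset]
      intro d hd e he h
      rcases (P.edge_eq_iff _ _).1 (Subtype.ext h) with h | h
      · exact h
      · exact absurd (h ▸ ((hD d).1 hd).1) ((hD e).1 he).2
    have hX : X.ncard = S.ncard := by
      have : S = (fun v => (P.vert v : α)) '' X := by
        ext x
        constructor
        · intro hx
          obtain ⟨v, hv⟩ := P.vert.surjective ⟨x, hS hx⟩
          have hv : (P.vert v : α) = x := by rw [hv]
          exact ⟨v, by rwa [← hv] at hx, hv⟩
        · rintro ⟨v, hv, rfl⟩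
          exact hv
      rw [this, Set.ncard_image_of_injective _ fun v w h => P.vert_inj.1 h]
    have hpar : ((D.card : ℕ) : ZMod 2) = 1 := by
      -- The constant `1` is antisymmetric modulo `2`, so this counts crossing half-edges by parity.
      have h1 := M.sum_eq_sum_crossing (fun _ => (1 : ZMod 2)) (fun _ => by decide) X
      rw [CubicMap.sum_fst_mem] at h1
      have h2 : ∑ _i : Fin 3, (1 : ZMod 2) = 1 := by decide
      simp only [h2, Finset.sum_const, nsmul_eq_mul, mul_one] at h1
      rw [show D.card = _ from rfl, ← h1]
      have h3 : (Finset.univ.filter fun v => v ∈ X).card = S.ncard := by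
        rw [← hX, ← Set.ncard_coe_finset]
        congr 1
        ext v
        simp
      rw [h3]
      exact (ZMod.natCast_eq_one_iff_odd).2 hodd
    rw [ZMod.natCast_eq_one_iff_odd] at hpar
    rw [hcard]
    have hne : D.card ≠ 1 := by
      intro h1
      obtain ⟨d, hd⟩ := Finset.card_eq_one.1 h1
      have hd' := (hD d).1 (by rw [hd]; simp)
      refine hd'.2 (hM d X hd'.1 fun e h1 h2 h3 => ?_)
      by_contra h4
      have := (hD e).2 ⟨h3, h4⟩
      rw [hd, Finset.mem_singleton] at this
      exact h1 this
    obtain ⟨m, hm⟩ := hpar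
    omega

end Presentation

/-- Every finite loopless cubic graph has a presentation. -/
lemma exists_presentation {α β : Type} {G : Graph α β} (hG : IsFiniteLoopless G)
    (hr : IsRegular G 3) : ∃ M : CubicMap V(G), Nonempty (Presentation M G) := by
  classical
  have := hG.loopless
  have heq : ∀ x : V(G), Nonempty (Fin 3 ≃ G.incidenceSet x) := by
    intro x
    have h : Nat.card (G.incidenceSet x) = 3 := hr x x.2
    have : Finite (G.incidenceSet x) := Nat.finite_of_card_ne_zero (by omega)
    exact ⟨(Finite.equivFinOfCardEq h).symm⟩
  let eq : ∀ x : V(G), Fin 3 ≃ G.incidenceSet x := fun x => (heq x).some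
  have hex : ∀ d : V(G) × Fin 3, ∃ d' : V(G) × Fin 3,
      G.IsLink (eq d.1 d.2) d.1 d'.1 ∧ (eq d'.1 d'.2 : β) = eq d.1 d.2 := by
    rintro ⟨x, i⟩
    obtain ⟨y, hy⟩ := (eq x i).2
    refine ⟨(⟨y, hy.right_mem⟩, (eq ⟨y, hy.right_mem⟩).symm ⟨eq x i, hy.inc_right⟩), hy, ?_⟩
    simp
  choose inv h1 h2 using hex
  have ext_dart : ∀ d e : V(G) × Fin 3, d.1 = e.1 → (eq d.1 d.2 : β) = eq e.1 e.2 → d = e := by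
    rintro ⟨x, i⟩ ⟨y, k⟩ (rfl : x = y) h
    exact Prod.ext rfl ((eq x).injective (Subtype.ext h))
  have hne : ∀ d, (inv d).1 ≠ d.1 := fun d h => (h1 d).ne (by rw [h])
  have inv_inv : ∀ d, inv (inv d) = d := by
    intro d
    refine ext_dart _ _ ?_ ((h2 _).trans (h2 d))
    have h3 := h1 (inv d)
    rw [h2 d] at h3
    exact Subtype.ext (h3.right_unique (h1 d).symm)
  refine ⟨⟨inv, inv_inv, hne⟩, ⟨⟨Equiv.refl _, fun d => ⟨eq d.1 d.2, (h1 d).edge_mem⟩, h1,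
    fun d e => ⟨fun h => ?_, ?_⟩, ?_⟩⟩⟩
  · have h : (eq d.1 d.2 : β) = eq e.1 e.2 := congrArg Subtype.val h
    have h3 := h1 d
    rw [h] at h3
    rcases (h3.eq_and_eq_or_eq_and_eq (h1 e)) with h4 | h4
    · exact Or.inl (ext_dart _ _ (Subtype.ext h4.1) h)
    · exact Or.inr (ext_dart _ _ (Subtype.ext h4.1) (h.trans (h2 e).symm))
  · rintro (rfl | rfl)
    · rfl
    · exact Subtype.ext (h2 e)
  · rintro ⟨e, he⟩
    obtain ⟨x, y, hl⟩ := G.exists_isLink_of_mem_edgeSet he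
    refine ⟨(⟨x, hl.left_mem⟩, (eq ⟨x, hl.left_mem⟩).symm ⟨e, hl.inc_left⟩), ?_⟩
    simp

/-! ### The rotation graph as a simple `Graph` -/

namespace CubicMap

variable {V : Type}

/-- The simple graph underlying a cubic graph. -/
def toSimpleGraph (M : CubicMap V) : SimpleGraph V where
  Adj v w := ∃ i, (M.inv (v, i)).1 = w
  symm := ⟨by
    rintro v _ ⟨i, rfl⟩
    exact ⟨(M.inv (v, i)).2, congrArg Prod.fst (M.inv_inv (v, i))⟩⟩
  loopless := ⟨by
    rintro v ⟨i, h⟩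
    exact M.fst_inv_ne (v, i) h⟩

/-- A cubic graph without parallel edges presents its underlying simple graph. -/
noncomputable def presentation (M : CubicMap V)
    (hM : ∀ v, Function.Injective fun i => (M.inv (v, i)).1) :
    Presentation M (Graph.ofSimpleGraph M.toSimpleGraph) where
  vert := (Equiv.Set.univ V).symm
  edge d := ⟨s(d.1, (M.inv d).1), ⟨d.2, rfl⟩⟩
  isLink d := ⟨rfl, ⟨d.2, rfl⟩⟩
  edge_eq_iff d e := by
    have ext_dart : ∀ d e : V × Fin 3, d.1 = e.1 → (M.inv d).1 = (M.inv e).1 → d = e := by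
      rintro ⟨v, i⟩ ⟨w, k⟩ (rfl : v = w) h
      exact Prod.ext rfl (hM v h)
    refine Subtype.ext_iff.trans (Sym2.eq_iff.trans ?_)
    constructor
    · rintro (⟨h1, h2⟩ | ⟨h1, h2⟩)
      · exact Or.inl (ext_dart _ _ h1 h2)
      · exact Or.inr (ext_dart _ _ h1 (by rw [h2, M.inv_inv]))
    · rintro (rfl | rfl)
      · exact Or.inl ⟨rfl, rfl⟩
      · exact Or.inr ⟨rfl, by rw [M.inv_inv]⟩
  edge_surjective := by
    rintro ⟨e, he⟩
    induction e with
    | _ v w =>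
      obtain ⟨i, rfl⟩ : ∃ i, (M.inv (v, i)).1 = w := he
      exact ⟨(v, i), rfl⟩

end CubicMap

lemma simple_ofSimpleGraph {V : Type} (H : SimpleGraph V) : (Graph.ofSimpleGraph H).Simple where
  not_isLoopAt e x := by
    rintro ⟨rfl, h⟩
    exact H.loopless.irrefl x h
  eq_of_isLink := by
    rintro e f x y ⟨rfl, -⟩ ⟨rfl, -⟩
    rfl

namespace RootedCubicMap

variable {V : Type} (R : RootedCubicMap V) (B : ℕ)

/-- The rotation graph as a graph with vertices and edges. -/
noncomputable def rotGraph : Graph (R.RotVertex B) (Sym2 (R.RotVertex B)) :=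
  Graph.ofSimpleGraph (R.rotation B).toSimpleGraph

variable {R B}

/-- The presentation of the rotation graph. -/
noncomputable def rotPresentation (hB : ∀ v, R.depth v ≤ B) :
    Presentation (R.rotation B) (R.rotGraph B) :=
  (R.rotation B).presentation (rotation_simple hB)

lemma isRotationTreeGraph [Finite V] (hB : ∀ v, R.depth v ≤ B) :
    IsRotationTreeGraph (R.rotGraph B) 3 (B + 3) := by
  let P := rotPresentation hB
  let e : V(R.rotGraph B) ≃ R.RotVertex B := Equiv.Set.univ _
  let T : SimpleGraph V(R.rotGraph B) := (R.rotTree B).comap e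
  let φ : T ≃g R.rotTree B := SimpleGraph.Iso.comap e _
  let σ : Equiv.Perm V(R.rotGraph B) := (e.trans (R.rotate B)).trans e.symm
  have hφ : ∀ x, φ x = e x := fun _ => rfl
  have hσ : ∀ x, e (σ x) = R.rotate B (e x) := fun x => e.apply_symm_apply _
  have hσ_semi : Function.Semiconj e σ (R.rotate B) := hσ
  refine ⟨P.isFiniteLoopless, P.isRegular, T, e.symm none, σ, ?_, ?_, ?_, ?_⟩
  · intro x y h
    refine ⟨h.ne, s(x.1, y.1), rfl, ?_⟩
    exact exists_inv_eq_of_rotTree_adj h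
  · refine IsRootedTree.of_iso φ ?_
    rw [hφ, e.apply_symm_apply]
    exact isRootedTree_rotTree hB
  · intro x y
    have h : ∀ x y : V(R.rotGraph B), {f | (R.rotGraph B).IsLink f x y} =
        {f | f = s(x.1, y.1) ∧ ∃ i, (R.rotInv B (x.1, i)).1 = y.1} := by
      intro x y
      ext f
      constructor
      · rintro ⟨rfl, h⟩
        exact ⟨rfl, h⟩
      · rintro ⟨rfl, h⟩
        exact ⟨rfl, h⟩
    have key := exists_inv_rotate_iff (B := B) x.1 y.1
    rw [h, h]
    by_cases hxy : ∃ i, (R.rotInv B (x.1, i)).1 = y.1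
    · have hxy' : ∃ i, (R.rotInv B ((σ x).1, i)).1 = (σ y).1 := key.2 hxy
      simp only [hxy, hxy', and_true]
      exact (Set.ncard_singleton _).trans (Set.ncard_singleton _).symm
    · have hxy' : ¬ ∃ i, (R.rotInv B ((σ x).1, i)).1 = (σ y).1 := fun h => hxy (key.1 h)
      simp only [hxy, hxy', and_false]
  · have period : ∀ x, Function.minimalPeriod σ x = Function.minimalPeriod (R.rotate B) (e x) := by
      intro x
      refine Function.minimalPeriod_eq_minimalPeriod_iff.2 fun n => ?_
      rw [Function.IsPeriodicPt, Function.IsPeriodicPt, Function.IsFixedPt, Function.IsFixedPt,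
        ← (hσ_semi.iterate_right n).eq, e.apply_eq_iff_eq]
    have hrot := isRotational_rotate (R := R) hB
    refine ⟨fun x y => ?_, ?_, fun x hx => ?_⟩
    · change (R.rotTree B).Adj (e (σ x)) (e (σ y)) ↔ (R.rotTree B).Adj (e x) (e y)
      rw [hσ, hσ]
      exact hrot.adj_iff _ _
    · rw [period, e.apply_symm_apply]
      exact hrot.period_self
    · rw [period, ncard_neighborSet_of_iso φ, hφ, e.apply_symm_apply]
      exact hrot.period_of_ne _ fun h => hx (by rw [← h, e.symm_apply_apply])

end RootedCubicMap

/-! ### The reduction -/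

/-- From every snark there is a simple rotation snark whose flows restrict to the snark. -/
lemma IsSnark.exists_rotationSnark {α β : Type} {G : Graph α β} (hG : IsSnark G) :
    ∃ (W : Type) (H : Graph W (Sym2 W)), H.Simple ∧ IsRotationSnark H ∧
      ∀ k, HasNowhereZeroFlow H k → HasNowhereZeroFlow G k := by
  obtain ⟨M, ⟨P⟩⟩ := exists_presentation hG.finite_loopless hG.cubic
  have : Finite V(G) := hG.finite_loopless.finite_vertexSet
  -- The graph without vertices is 3-edge-colourable, so a snark has a vertex to serve as root.
  have : Nonempty V(G) := by
    by_contra h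
    rw [not_nonempty_iff] at h
    exact hG.not_edgeColorable (P.edgeColorable_iff.2
      ⟨0, fun d => isEmptyElim d.1, fun v => isEmptyElim v, fun d => isEmptyElim d.1⟩)
  obtain ⟨M', hM', hc, hflow⟩ := (P.bridgeless_iff.1 hG.bridgeless).exists_connected
  obtain ⟨R, π, hR⟩ := hM'.exists_rooted hc
  obtain ⟨B, hB⟩ := (Set.finite_range R.depth).bddAbove
  have hB : ∀ v, R.depth v ≤ B := fun v => hB ⟨v, rfl⟩
  -- Used twice: with the Klein four-group for non-colourability and with `ℤ` for the flows.
  have transfer : ∀ (A : Type) [AddCommGroup A] (S : Set A),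
      (∃ f, (R.rotation B).IsFlow S f) → ∃ f, M.IsFlow S f := by
    rintro A _ S ⟨f, hf⟩
    have h := RootedCubicMap.isFlow_of_rotation hf
    rw [hR] at h
    exact ⟨_, hflow A S _ h.of_relabel⟩
  have hbr : (R.rotation B).Bridgeless :=
    RootedCubicMap.bridgeless_rotation (by rw [hR]; exact hM'.relabel π)
  let Q := RootedCubicMap.rotPresentation hB
  refine ⟨_, R.rotGraph B, simple_ofSimpleGraph _, ⟨⟨Q.isFiniteLoopless, Q.isRegular,
    Q.bridgeless_iff.2 hbr, fun h => ?_⟩, Q.isRGraph hbr, B + 3,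
    RootedCubicMap.isRotationTreeGraph hB⟩, fun k h => ?_⟩
  · exact hG.not_edgeColorable (P.edgeColorable_iff.2 (transfer _ _ (Q.edgeColorable_iff.1 h)))
  · exact (P.hasNowhereZeroFlow_iff k).2 (transfer _ _ ((Q.hasNowhereZeroFlow_iff k).1 h))

end SnarkFlow

theorem mainTheorem5 :
    (∀ (α β : Type) (G : Graph α β),
      SnarkFlow.IsSnark G → SnarkFlow.HasNowhereZeroFlow G 5) ↔
    (∀ (α β : Type) (G : Graph α β),
      G.Simple → SnarkFlow.IsRotationSnark G → SnarkFlow.HasNowhereZeroFlow G 5) := by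
  refine ⟨fun h α β G _ hG => h α β G hG.1, fun h α β G hG => ?_⟩
  obtain ⟨W, H, hs, hH, hflow⟩ := hG.exists_rotationSnark
  exact hflow 5 (h W _ H hs hH)
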